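/- **Theorem (Regularity of inputs does not imply regularity of the median).** *Notation.* Currents are taken in $\mathbb R^2$: a $p$-current is a continuous linear functional on smooth compactly supported $p$-forms, $\partial T(\omega)=T(d\omega)$, and $M(T)=\sup\{T(\omega):|\omega|\le 1\}$ is the mass. For $\lambda>0$ the multiscale flat norm is $$\mathbb F_\lambda(H)=\inf_{S}\;\big(M(H-\partial S)+\lambda M(S)\big),$$ the infimum being over all currents $S$ of one dimension higher. A $1$-current is integral if it and its boundary are rectifiable currents with integer multiplicities. For a measurable set $E\subset\mathbb R^2$ of finite measure, $[[E]](\omega)=\int_E\omega(e_1\wedge e_2)\,d\mathcal L^2$; $E$ has finite perimeter if $M(\partial[[E]])<\infty$. Given a set $E$ of finite perimeter and a bounded open set $U$ with $M(\partial(\partial[[E]]\llcorner U))<\infty$, let $\mathcal E_U$ be the class of integral $1$-currents of the form $S=\partial[[F]]\llcorner U$, where $F$ is a set of finite perimeter with $F\setminus U'=E\setminus U'$ for some open $U'\subset\subset U$ (pieces of boundaries of sets). For $T_1,\dots,T_N\in\mathcal E_U$, a median is a minimizer over $T\in\mathcal E_U$ of $\sum_{i=1}^N\mathbb F_\lambda(T-T_i)$.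 The scale $\lambda>0$ is called admissible for $T_1,\dots,T_N$ if for every $T\in\mathcal E_U$ and every $i$ the infimum defining $\mathbb F_\lambda(T-T_i)$ is attained at some $S$ with $\partial S=T-T_i$. A $1$-current $T$ is $C^k$ ($1\le k\le\infty$) at a point $q$ of its support if $\operatorname{supp}T$ is an embedded $C^k$ curve in a neighbourhood of $q$. *Statement.* There exist $N\ge 1$, smooth functions $f_1,\dots,f_N:\mathbb R\to\mathbb R$ with $f_i(0)=f_i(1)=1$, a set $E$ of finite perimeter and a bounded open set $U$ with $M(\partial(\partial[[E]]\llcorner U))<\infty$, and a point $p\in\mathbb R^2$, such that the following hold for the currents $T_i$ given by the graphs $\{(x,f_i(x)):x\in[0,1]\}$ oriented by the unit vector fields $(-1,-f_i'(x))/\sqrt{1+f_i'(x)^2}$. 1. Each $T_i$ belongs to $\mathcal E_U$ and is $C^\infty$ at every point of $\operatorname{supp}T_i\setminus\operatorname{supp}\partial T_i$, and $\partial T_i=\partial T_j$ for all $i,j$. 2. There is $\lambda_0>0$ such that every $\lambda\in(0,\lambda_0)$ is admissible for $T_1,\dots,T_N$. 3. For every admissible $\lambda>0$ a median of $T_1,\dots,T_N$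 exists, and every median $\hat T$ satisfies $p\in\operatorname{supp}\hat T\setminus\operatorname{supp}\partial\hat T$ and is not $C^1$ at $p$. In particular, inputs that are smooth with shared boundary can have a set of medians consisting only of currents that are non-smooth somewhere. -/

import Mathlib

open MeasureTheory Set Topology
open scoped Distributions ContDiff NNReal ENNReal

namespace MedianCurrents

noncomputable section

/-- The Euclidean plane. -/
abbrev Plane : Type := EuclideanSpace ℝ (Fin 2)

/-- Smooth, compactly supported differential `p`-forms on the plane. The norm on the values
`Plane [⋀^Fin p]→L[ℝ] ℝ` is the comass norm, the supremum of `ω (v₁, …, vₚ)` over unit vectors. -/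
abbrev TestForm (p : ℕ) : Type :=
  𝓓((⊤ : TopologicalSpace.Opens Plane), Plane [⋀^Fin p]→L[ℝ] ℝ)

/-- A `p`-current in the plane: an element of the (continuous) dual of the space of smooth
compactly supported `p`-forms with its usual LF topology. -/
abbrev Current (p : ℕ) : Type := TestForm p →L[ℝ] ℝ

/-- The exterior derivative on test forms. -/
def extD (p : ℕ) : TestForm p →L[ℝ] TestForm (p + 1) :=
  TestFunction.postcompCLM (ContinuousAlternatingMap.alternatizeUncurryFinCLM ℝ Plane ℝ) ∘L
    TestFunction.fderivCLM ℝ ⊤ ⊤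

theorem extD_apply {p : ℕ} (α : TestForm p) (x : Plane) : extD p α x = extDeriv α x := by
  simp [extD, extDeriv, TestFunction.fderivCLM_apply]

/-- The boundary of a current, `∂T (ω) = T (dω)`. -/
def boundary {p : ℕ} (T : Current (p + 1)) : Current p := T ∘L extD p

/-- The mass of a current. -/
def mass {p : ℕ} (T : Current p) : ℝ≥0∞ :=
  ⨆ (α : TestForm p) (_ : ∀ x, ‖α x‖ ≤ 1), ENNReal.ofReal (T α)

/-- The multiscale flat norm at scale `lam`, the infimum being over all `(p+1)`-currents. -/
def flatNorm {p : ℕ} (lam : ℝ≥0) (H : Current p) : ℝ≥0∞ :=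
  ⨅ S : Current (p + 1), mass (H - boundary S) + (lam : ℝ≥0∞) * mass S

/-- `R` is a rectifiable `p`-current: integration, with respect to the `p`-dimensional Hausdorff
measure, over a `p`-rectifiable set `A`, against an integrable integer multiplicity `m` and a unit
simple `p`-vector field orienting `A`. The `p`-vector is given by an orthonormal frame `ξ x`.
The set `A` is covered, up to a null set, by Lipschitz images `g k (ℝᵖ)`, and the span of `ξ` is
the tangent space of `A` almost everywhere, computed through these parametrizations. -/
def IsRectifiableCurrent {p : ℕ} (R : Current p) : Prop :=
  ∃ (A : Set Plane) (m : Plane → ℤ) (ξ : Plane → Fin p → Plane)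
    (g : ℕ → EuclideanSpace ℝ (Fin p) → Plane),
    MeasurableSet A ∧ Measurable m ∧ Measurable ξ ∧
    IntegrableOn (fun x => (m x : ℝ)) A μHE[p] ∧
    (∀ k, ∃ K : ℝ≥0, LipschitzWith K (g k)) ∧
    μHE[p] (A \ ⋃ k, range (g k)) = 0 ∧
    (∀ x ∈ A, Orthonormal ℝ (ξ x)) ∧
    (∀ k, ∀ᵐ t, g k t ∈ A → Function.Injective (fderiv ℝ (g k) t) →
      range (fderiv ℝ (g k) t) = (Submodule.span ℝ (range (ξ (g k t))) : Set Plane)) ∧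
    ∀ α : TestForm p, R α = ∫ x in A, (m x : ℝ) * α x (ξ x) ∂μHE[p]

/-- `R` is an integral current: both `R` and `∂R` are rectifiable. -/
def IsIntegralCurrent {p : ℕ} (R : Current (p + 1)) : Prop :=
  IsRectifiableCurrent R ∧ IsRectifiableCurrent (boundary R)

/-- `R = T ⌞ A`. Here `T` has finite mass, i.e. it is integration of forms against a finite
(`p`-vector valued) measure `m ξ μ`, and `R` is integration against the restriction of that measure
to `A`. The measure is determined by `T`, hence so is `R`. -/
def IsRestriction {p : ℕ} (T : Current p) (A : Set Plane) (R : Current p) : Prop :=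
  ∃ (μ : Measure Plane) (m : Plane → ℝ) (ξ : Plane → Fin p → Plane),
    IsFiniteMeasure μ ∧ Integrable m μ ∧ Measurable ξ ∧ (∀ x, Orthonormal ℝ (ξ x)) ∧
    (∀ α : TestForm p, T α = ∫ x, m x * α x (ξ x) ∂μ) ∧
    ∀ α : TestForm p, R α = ∫ x in A, m x * α x (ξ x) ∂μ

/-- The standard basis of the plane, as the orienting frame. -/
def stdFrame : Fin 2 → Plane := fun i => EuclideanSpace.single i 1

/-- The value of a `2`-covector on the standard orienting `2`-vector. -/
def evalStd : (Plane [⋀^Fin 2]→L[ℝ] ℝ) →L[ℝ] ℝ :=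
  ContinuousMultilinearMap.apply ℝ (fun _ : Fin 2 => Plane) ℝ stdFrame ∘L
    ContinuousAlternatingMap.toContinuousMultilinearMapCLM ℝ

/-- The `2`-current `[[E]]`, see `topCurrent_apply`. -/
def topCurrent (E : Set Plane) : Current 2 :=
  TestFunction.integralAgainstBilinCLM (ContinuousLinearMap.mul ℝ ℝ ∘L evalStd)
    (volume.restrict E) (fun _ => (1 : ℝ))

theorem topCurrent_apply (E : Set Plane) (α : TestForm 2) :
    topCurrent E α = ∫ x in E, α x stdFrame := by
  have h : LocallyIntegrableOn (fun _ : Plane => (1 : ℝ))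
      ((⊤ : TopologicalSpace.Opens Plane) : Set Plane) (volume.restrict E) :=
    (locallyIntegrable_const 1).locallyIntegrableOn _
  rw [topCurrent, TestFunction.integralAgainstBilinCLM_eq_integral h]
  simp [evalStd]

/-- Sets of finite perimeter: Lebesgue measurable, of finite measure, with `M(∂[[E]]) < ∞`. -/
def IsFinitePerimeter (E : Set Plane) : Prop :=
  NullMeasurableSet E volume ∧ volume E < ⊤ ∧ mass (boundary (topCurrent E)) < ⊤

/-- The standing assumptions on the reference set `E` and the window `U`. -/
def IsAdmissible (E U : Set Plane) : Prop :=
  IsFinitePerimeter E ∧ IsOpen U ∧ Bornology.IsBounded U ∧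
    ∃ R : Current 1, IsRestriction (boundary (topCurrent E)) U R ∧ mass (boundary R) < ⊤

/-- The class `𝓔_U` of pieces of boundaries of sets: the integral `1`-currents `S = ∂[[F]] ⌞ U`
with `F` a set of finite perimeter that agrees with `E` outside some open `U' ⊂⊂ U`. -/
def boundaryPieces (E U : Set Plane) : Set (Current 1) :=
  {S | IsIntegralCurrent S ∧ ∃ F : Set Plane, IsFinitePerimeter F ∧
    IsRestriction (boundary (topCurrent F)) U S ∧
    ∃ U' : Set Plane, IsOpen U' ∧ IsCompact (closure U') ∧ closure U' ⊆ U ∧ E \ U' = F \ U'}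

/-- `M` is a median of the currents `T i` over `𝓔_U`: a minimizer of `∑ i, 𝔽_lam (M - T i)`. -/
def IsMedian {N : ℕ} (lam : ℝ≥0) (E U : Set Plane) (T : Fin N → Current 1) (M : Current 1) :
    Prop :=
  M ∈ boundaryPieces E U ∧
    ∀ S ∈ boundaryPieces E U, ∑ i, flatNorm lam (M - T i) ≤ ∑ i, flatNorm lam (S - T i)

/-- The scale `lam` is small enough that, for every competitor `S`, the flat norm decomposition
of `S - T i` can be chosen to fill it completely, i.e. is attained at some `Q` with
`∂Q = S - T i`. -/
def FlatNormFills {N : ℕ} (lam : ℝ≥0) (E U : Set Plane) (T : Fin N → Current 1) : Prop :=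
  ∀ S ∈ boundaryPieces E U, ∀ i, ∃ Q : Current 2,
    boundary Q = S - T i ∧
      flatNorm lam (S - T i) = mass (S - T i - boundary Q) + (lam : ℝ≥0∞) * mass Q

/-- The graph of `f` over `[0,1]`. -/
def graphSet (f : ℝ → ℝ) : Set Plane := {q | q 0 ∈ Icc (0 : ℝ) 1 ∧ q 1 = f (q 0)}

/-- The unit vector field `(-1, -f') / √(1 + f'²)`. -/
def graphOrientation (f : ℝ → ℝ) (q : Plane) : Plane :=
  (Real.sqrt (1 + deriv f (q 0) ^ 2))⁻¹ • !₂[-1, -deriv f (q 0)]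

/-- `T` is the oriented graph of `f` over `[0,1]`, viewed as a `1`-current. -/
def IsGraphCurrent (f : ℝ → ℝ) (T : Current 1) : Prop :=
  ∀ α : TestForm 1, T α = ∫ q in graphSet f, α q (fun _ => graphOrientation f q) ∂μHE[1]

/-- The current `T` is a `C^k` curve near the point `q` of its support, `1 ≤ k`: in some
neighbourhood of `q` the support of `T` is an embedded `C^k` curve, that is, the zero set of a
`C^k` function with nonzero derivative at `q`. -/
def IsSmoothAt (k : ℕ∞) (T : Current 1) (q : Plane) : Prop :=
  ∃ (V : Set Plane) (φ : Plane → ℝ), IsOpen V ∧ q ∈ V ∧ ContDiffOn ℝ k φ V ∧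
    fderiv ℝ φ q ≠ 0 ∧ Distribution.dsupport T ∩ V = {x ∈ V | φ x = 0}

/-- The points of a `1`-current away from its boundary: `supp T \ supp ∂T`. -/
def interiorPoints (T : Current 1) : Set Plane :=
  Distribution.dsupport T \ Distribution.dsupport (boundary T)

end

end MedianCurrents

open MedianCurrents

/-! The inputs are three graphs over $[0,1]$: the segment at height 1, the segment plus
$b(x)(x-1/2)$, and the segment plus $b(x)/4$, where $b$ is a smooth bump equal to 1 near $1/2$. The
pointwise median of these functions is the upper envelope of the first two, which has a corner at
$x=1/2$. The proof shows that this graph is the only median current at every admissible scale.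

The link between currents and sets is as follows. Each input is the part inside the window of the
boundary of the region between `lowerCurve` and its graph. If $S$ is a competitor coming from a set
$F$ and $T_i$ comes from $F_i$, then $S-T_i=\partial([[F]]-[[F_i]])$, since $F$ and $F_i$ differ
only well inside the window (`sub_eq_boundary_of_isRestriction`). The flat norm is therefore at most
$\lambda|F\triangle F_i|$. Equality at an admissible scale needs a lower bound on the mass of every
filling. It comes from a calibration (`exists_calibration`): a compactly supported 1-form $\beta$
with $|d\beta|\le1$ and $d\beta$ close to $1$ on $F\setminus F_i$ and to $-1$ on $F_i\setminus F$.
Because $|\beta|$ is bounded by a constant depending only on the radius of a ball containing the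
sets, the same form shows that all small $\lambda$ are admissible (`measure_le_flatNorm`).

The median problem thus becomes minimizing $\sum_i|F\triangle F_i|$. Pointwise majority solves it,
and any other set loses at least its symmetric difference to the majority set
(`sum_symmDist_majority_add_le`). Here the majority set is the region under the envelope, so the
median is unique (`isMedian_iff_eq_graphCurrent`). A curve with two different one-sided slopes is
not the regular zero set of a $C^1$ function (`not_isSmoothAt_of_corner`).

The rest puts graphs of Lipschitz functions into the class: the area formula, Green's theorem
between two graphs, and the computation of restrictions and supports. -/

namespace MedianCurrents

noncomputable section

/-! ### Test forms, exterior derivative and comass in coordinates. -/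

/-- Scalar test functions on the plane. -/
abbrev ScalarTest : Type := 𝓓((⊤ : TopologicalSpace.Opens Plane), ℝ)

/-- The test form `φ w` with a constant covector `w`. -/
def constForm {p : ℕ} (w : Plane [⋀^Fin p]→L[ℝ] ℝ) (φ : ScalarTest) : TestForm p :=
  TestFunction.postcompCLM (ContinuousLinearMap.toSpanSingleton ℝ w) φ

@[simp]
theorem constForm_apply {p : ℕ} (w : Plane [⋀^Fin p]→L[ℝ] ℝ) (φ : ScalarTest) (x : Plane) :
    constForm w φ x = φ x • w := by
  simp [constForm]

/-- The coordinate covector `dxᵢ` as an alternating map. -/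
def coordForm (i : Fin 2) : Plane [⋀^Fin 1]→L[ℝ] ℝ :=
  ContinuousAlternatingMap.ofSubsingleton ℝ Plane ℝ 0 (EuclideanSpace.proj i)

@[simp]
theorem coordForm_apply (i : Fin 2) (v : Fin 1 → Plane) : coordForm i v = v 0 i := by
  simp [coordForm]

theorem norm_coordForm_le (i : Fin 2) : ‖coordForm i‖ ≤ 1 := by
  refine ContinuousAlternatingMap.opNorm_le_bound _ zero_le_one fun v => ?_
  simpa using PiLp.norm_apply_le (v 0) i

theorem extD_one_apply (β : TestForm 1) (x : Plane) (v : Fin 2 → Plane) :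
    extD 1 β x v =
      fderiv ℝ β x (v 0) (fun _ => v 1) - fderiv ℝ β x (v 1) (fun _ => v 0) := by
  rw [extD_apply, extDeriv, ContinuousAlternatingMap.alternatizeUncurryFin_apply]
  simp [Fin.sum_univ_two, sub_eq_add_neg]
  congr 2 <;> (try congr 1) <;> (funext i; fin_cases i; rfl)

theorem extD_zero_apply (β : TestForm 0) (x : Plane) (v : Fin 1 → Plane) :
    extD 0 β x v = fderiv ℝ β x (v 0) 0 := by
  rw [extD_apply, extDeriv, ContinuousAlternatingMap.alternatizeUncurryFin_apply]
  simp
  congr 1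
  exact Subsingleton.elim _ _

theorem extD_extD {p : ℕ} (β : TestForm p) : extD (p + 1) (extD p β) = 0 := by
  ext1 x
  rw [extD_apply]
  have h : (⇑(extD p β) : Plane → _) = extDeriv β := funext fun y => extD_apply β y
  have h2 : extDeriv (extDeriv (β : Plane → Plane [⋀^Fin p]→L[ℝ] ℝ)) = 0 :=
    extDeriv_extDeriv β.contDiff (by simpa using WithTop.coe_le_coe.2 (le_top : (2 : ℕ∞) ≤ ⊤))
  rw [h, h2]
  rfl

/-- A 2-covector on the plane is a multiple of the determinant, and $|\det(v_0,v_1)|\le|v_0||v_1|$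
by Lagrange's identity $|v_0|^2|v_1|^2-\det^2=\langle v_0,v_1\rangle^2$. -/
theorem norm_le_abs_apply_stdFrame (w : Plane [⋀^Fin 2]→L[ℝ] ℝ) : ‖w‖ ≤ |w stdFrame| := by
  have key (v : Fin 2 → Plane) : w v = (v 0 0 * v 1 1 - v 0 1 * v 1 0) * w stdFrame := by
    have h := AlternatingMap.eq_smul_basis_det (EuclideanSpace.basisFun (Fin 2) ℝ).toBasis
      w.toAlternatingMap
    have h2 := congrArg (fun f => f v) h
    simp only [AlternatingMap.smul_apply, Module.Basis.det_apply, Matrix.det_fin_two,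
      Module.Basis.toMatrix_apply, smul_eq_mul] at h2
    have e : (⇑(EuclideanSpace.basisFun (Fin 2) ℝ).toBasis : Fin 2 → Plane) = stdFrame := by
      funext i; simp [stdFrame]
    rw [e] at h2
    simp at h2
    rw [h2]; ring
  refine ContinuousAlternatingMap.opNorm_le_bound _ (abs_nonneg _) fun v => ?_
  rw [key v, Real.norm_eq_abs, abs_mul, mul_comm]
  refine mul_le_mul_of_nonneg_left ?_ (abs_nonneg _)
  rw [Fin.prod_univ_two, EuclideanSpace.norm_eq, EuclideanSpace.norm_eq,
    ← Real.sqrt_mul (Finset.sum_nonneg fun i _ => sq_nonneg _)]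
  refine Real.abs_le_sqrt ?_
  simp only [Fin.sum_univ_two, Real.norm_eq_abs, sq_abs]
  nlinarith [sq_nonneg (v 0 0 * v 1 0 + v 0 1 * v 1 1)]

theorem extD_one_stdFrame (β : TestForm 1) (x : Plane) :
    extD 1 β x stdFrame = fderiv ℝ (fun y => β y fun _ => stdFrame 1) x (stdFrame 0) -
      fderiv ℝ (fun y => β y fun _ => stdFrame 0) x (stdFrame 1) := by
  have h (v : Fin 1 → Plane) (w : Plane) :
      fderiv ℝ (fun y => β y v) x w = fderiv ℝ β x w v := by
    have hd : DifferentiableAt ℝ β x := β.contDiff.differentiable (by simp) x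
    have h1 := ((ContinuousMultilinearMap.apply ℝ (fun _ : Fin 1 => Plane) ℝ v ∘L
      ContinuousAlternatingMap.toContinuousMultilinearMapCLM ℝ).hasFDerivAt).comp x hd.hasFDerivAt
    have h2 : HasFDerivAt (fun y => β y v) _ x := h1
    rw [h2.fderiv]; rfl
  rw [extD_one_apply, h, h]

theorem ofReal_le_mass {p : ℕ} (T : Current p) {α : TestForm p} (hα : ∀ x, ‖α x‖ ≤ 1) :
    ENNReal.ofReal (T α) ≤ mass T :=
  le_iSup₂ (f := fun (α : TestForm p) (_ : ∀ x, ‖α x‖ ≤ 1) => ENNReal.ofReal (T α)) α hα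

/-! ### Calibrations and lower bounds for fillings. -/

/-- A smooth compactly supported function, averaged over a segment of direction `v`, is a primitive
in direction `v` of the difference between the function and its translate. -/
theorem exists_segment_average (η : ScalarTest) (v : Plane) (hη : ∀ x, |η x| ≤ 1) :
    ∃ ψ : ScalarTest, (∀ x, |ψ x| ≤ 1) ∧ ∀ x, fderiv ℝ ψ x v = η x - η (x - v) := by
  have hm : Measurable fun s : ℝ => s • v := by fun_prop
  have : IsProbabilityMeasure (volume.restrict (Icc (0 : ℝ) 1)) := ⟨by simp⟩
  -- As a convolution with the uniform measure on the segment from $0$ to $v$, the average is smooth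
  -- at once; its parametric form gives the support and the derivative.
  set μ : Measure Plane := (volume.restrict (Icc (0 : ℝ) 1)).map (fun s : ℝ => s • v) with hμ
  have : IsProbabilityMeasure μ := Measure.isProbabilityMeasure_map hm.aemeasurable
  have hl : LocallyIntegrable (fun _ : Plane => (1 : ℝ)) μ := locallyIntegrable_const 1
  set ψ : Plane → ℝ := convolution (fun _ => (1 : ℝ)) η (ContinuousLinearMap.mul ℝ ℝ) μ with hψ
  have hsmooth : ContDiff ℝ ∞ ψ :=
    η.hasCompactSupport.contDiff_convolution_right _ hl η.contDiff
  have hcont := η.continuous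
  have hval (x : Plane) : ψ x = ∫ s in (0 : ℝ)..1, η (x - s • v) := by
    rw [intervalIntegral.integral_of_le zero_le_one, ← integral_Icc_eq_integral_Ioc, hψ,
      convolution, hμ, integral_map hm.aemeasurable]
    · simp
    · exact (by fun_prop : Continuous fun t => ContinuousLinearMap.mul ℝ ℝ 1 (η (x - t))
        ).aestronglyMeasurable
  have hcs : HasCompactSupport ψ := by
    have hK : IsCompact ((fun q : Plane × ℝ => q.1 + q.2 • v) '' (tsupport η ×ˢ Icc (0 : ℝ) 1)) :=
      (η.hasCompactSupport.isCompact.prod isCompact_Icc).image (by fun_prop)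
    refine HasCompactSupport.intro hK fun x hx => ?_
    rw [hval]
    refine (intervalIntegral.integral_congr fun s hs => ?_).trans (by simp : ∫ s in (0 : ℝ)..1,
      (0 : ℝ) = 0)
    rw [uIcc_of_le zero_le_one] at hs
    refine image_eq_zero_of_notMem_tsupport fun h => hx ⟨(x - s • v, s), ⟨h, hs⟩, by simp⟩
  refine ⟨⟨ψ, hsmooth, hcs, by simp⟩, fun x => ?_, fun x => ?_⟩
  · change |ψ x| ≤ 1
    rw [hval]
    simpa using intervalIntegral.norm_integral_le_of_norm_le_const (a := 0) (b := 1)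
      (f := fun s : ℝ => η (x - s • v)) (C := 1) fun s _ => hη _
  · change fderiv ℝ ψ x v = _
    have h1 : HasDerivAt (fun t : ℝ => ψ (x + t • v)) (fderiv ℝ ψ x v) 0 := by
      have ha : HasDerivAt (fun t : ℝ => x + t • v) v 0 := by
        simpa using ((hasDerivAt_id (0 : ℝ)).smul_const v).const_add x
      have hb : HasFDerivAt ψ (fderiv ℝ ψ x) (x + (0 : ℝ) • v) := by
        simpa using (hsmooth.differentiable (by simp) x).hasFDerivAt
      exact hb.comp_hasDerivAt (0 : ℝ) ha
    set g : ℝ → ℝ := fun u => η (x + u • v) with hg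
    have hgc : Continuous g := by fun_prop
    -- Along the line through $x$ in direction $v$, `ψ` is the integral of `g` over the sliding
    -- interval $[t-1,t]$.
    have h2 (t : ℝ) : ψ (x + t • v) = (∫ u in (0 : ℝ)..t, g u) - ∫ u in (0 : ℝ)..(t - 1), g u := by
      rw [hval, intervalIntegral.integral_interval_sub_left (hgc.intervalIntegrable _ _)
        (hgc.intervalIntegrable _ _)]
      have := intervalIntegral.integral_comp_sub_left (a := 0) (b := 1) g t
      rw [sub_zero] at this
      rw [← this]
      congr 1 with s
      simp only [hg]
      congr 1
      module
    have h3 : HasDerivAt (fun t : ℝ => ψ (x + t • v)) (g 0 - g (0 - 1)) 0 := by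
      simp_rw [h2]
      have hd (t : ℝ) : HasDerivAt (fun t => ∫ u in (0 : ℝ)..t, g u) (g t) t :=
        intervalIntegral.integral_hasDerivAt_right (hgc.intervalIntegrable _ _)
          (hgc.stronglyMeasurableAtFilter _ _) hgc.continuousAt
      exact (hd 0).sub ((hd (0 - 1)).comp_sub_const 0 1)
    rw [h1.unique h3]
    simp [hg, sub_eq_add_neg]

open scoped Manifold in
theorem exists_contDiff_zero_iff_one_iff {s t : Set Plane} (hs : IsClosed s) (ht : IsClosed t)
    (hd : Disjoint s t) : ∃ f : Plane → ℝ, ContDiff ℝ ∞ f ∧ (∀ x, f x ∈ Icc (0 : ℝ) 1) ∧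
      (∀ x, x ∈ s ↔ f x = 0) ∧ ∀ x, x ∈ t ↔ f x = 1 := by
  obtain ⟨f, hf, hr, h0, h1⟩ :=
    exists_contMDiff_zero_iff_one_iff_of_isClosed (n := (⊤ : ℕ∞)) 𝓘(ℝ, Plane) hs ht hd
  exact ⟨f, hf.contDiff, fun x => hr (mem_range_self x), h0, h1⟩

theorem exists_isCompact_measureReal_diff_le {A : Set Plane} (hA : NullMeasurableSet A volume)
    (hfin : volume A ≠ ⊤) {δ : ℝ} (hδ : 0 < δ) :
    ∃ K ⊆ A, IsCompact K ∧ volume.real (A \ K) ≤ δ := by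
  obtain ⟨A', hA'A, hA'm, hA'e⟩ := hA.exists_measurable_subset_ae_eq
  have hfin' : volume A' ≠ ⊤ := measure_ne_top_of_subset hA'A hfin
  obtain ⟨K, hKA, hK, hlt⟩ := hA'm.exists_isCompact_sdiff_lt hfin'
    (ENNReal.ofReal_pos.2 hδ).ne'
  refine ⟨K, hKA.trans hA'A, hK, ?_⟩
  have : volume (A \ K) = volume (A' \ K) :=
    measure_congr (hA'e.symm.diff (Filter.EventuallyEq.refl _ _))
  rw [measureReal_def, this]
  exact ENNReal.toReal_le_of_le_ofReal hδ.le hlt.le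

/-- The integrand $1-\eta$ vanishes on $K$ and is at most 2 elsewhere. -/
theorem measureReal_sub_setIntegral_le {A K : Set Plane}
    (hfin : volume A ≠ ⊤) (hK : IsCompact K) {η : Plane → ℝ} (hη : Continuous η)
    (h1 : ∀ x, |η x| ≤ 1) (hηK : ∀ x ∈ K, η x = 1) :
    volume.real A - ∫ x in A, η x ≤ 2 * volume.real (A \ K) := by
  have : IsFiniteMeasure (volume.restrict A) := ⟨by simpa using hfin.lt_top⟩
  have hint : Integrable η (volume.restrict A) :=
    Integrable.of_bound hη.aestronglyMeasurable 1 (Filter.Eventually.of_forall h1)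
  have h2 : volume.real A - ∫ x in A, η x = ∫ x in A, (1 - η x) := by
    rw [integral_sub (integrable_const _) hint]
    simp
  have h3 : ∫ x in A, (Kᶜ).indicator (fun _ => (2 : ℝ)) x = 2 * volume.real (A \ K) := by
    rw [integral_indicator hK.measurableSet.compl]
    simp [Measure.restrict_restrict hK.measurableSet.compl, inter_comm, sdiff_eq, mul_comm]
  rw [h2, ← h3]
  refine integral_mono ((integrable_const _).sub hint)
    ((integrable_const _).indicator hK.measurableSet.compl) fun x => ?_
  by_cases hx : x ∈ K
  · simp [hx, hηK x hx]
  · simp only [mem_compl_iff, hx, not_false_eq_true, indicator_of_mem]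
    linarith [(abs_le.1 (h1 x)).1]

/-- A smooth approximation of $1_A-1_B$: the difference of two Urysohn functions for compact subsets
of $A$ and $B$. Each compact set misses measure at most $\varepsilon/4$, and each miss costs a
factor 2. -/
theorem exists_scalarTest_approx {A B : Set Plane} (hA : NullMeasurableSet A volume)
    (hB : NullMeasurableSet B volume) (hd : Disjoint A B) {R : ℝ}
    (hAR : A ⊆ Metric.ball 0 R) (hBR : B ⊆ Metric.ball 0 R) {ε : ℝ} (hε : 0 < ε) :
    ∃ η : ScalarTest, (∀ x, |η x| ≤ 1) ∧ (∀ x, R ≤ ‖x‖ → η x = 0) ∧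
      volume.real A + volume.real B - ε ≤ (∫ x in A, η x) - ∫ x in B, η x := by
  have hfin {A : Set Plane} (hA : A ⊆ Metric.ball 0 R) : volume A ≠ ⊤ :=
    measure_ne_top_of_subset hA measure_ball_lt_top.ne
  obtain ⟨K, hKA, hK, hKε⟩ := exists_isCompact_measureReal_diff_le hA (hfin hAR)
    (by positivity : 0 < ε / 4)
  obtain ⟨L, hLB, hL, hLε⟩ := exists_isCompact_measureReal_diff_le hB (hfin hBR)
    (by positivity : 0 < ε / 4)
  have hO : IsClosed ((Metric.ball (0 : Plane) R)ᶜ) := Metric.isOpen_ball.isClosed_compl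
  have hKL : Disjoint K L := hd.mono hKA hLB
  obtain ⟨f, hf, hf01, hf0, hf1⟩ := exists_contDiff_zero_iff_one_iff (hL.isClosed.union hO)
    hK.isClosed (disjoint_union_left.2 ⟨hKL.symm,
      (disjoint_compl_right.mono_left (hKA.trans hAR)).symm⟩)
  obtain ⟨g, hg, hg01, hg0, hg1⟩ := exists_contDiff_zero_iff_one_iff (hK.isClosed.union hO)
    hL.isClosed (disjoint_union_left.2 ⟨hKL,
      (disjoint_compl_right.mono_left (hLB.trans hBR)).symm⟩)
  have hout (x : Plane) (hx : R ≤ ‖x‖) : f x - g x = 0 := by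
    have h1 := (hf0 x).1 (Or.inr (by simpa using hx))
    have h2 := (hg0 x).1 (Or.inr (by simpa using hx))
    simp [h1, h2]
  have hcs : HasCompactSupport fun x => f x - g x := by
    refine HasCompactSupport.intro (isCompact_closedBall (0 : Plane) R) fun x hx => hout x ?_
    simp only [mem_closedBall_zero_iff, not_le] at hx
    exact hx.le
  refine ⟨⟨fun x => f x - g x, hf.sub hg, hcs, by simp⟩, fun x => ?_, hout, ?_⟩
  · change |f x - g x| ≤ 1
    have h1 := hf01 x
    have h2 := hg01 x
    rw [abs_le]
    constructor <;> linarith [h1.1, h1.2, h2.1, h2.2]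
  · change _ ≤ (∫ x in A, (f x - g x)) - ∫ x in B, (f x - g x)
    have hb (x : Plane) : |f x - g x| ≤ 1 := by
      have h1 := hf01 x
      have h2 := hg01 x
      rw [abs_le]
      constructor <;> linarith [h1.1, h1.2, h2.1, h2.2]
    have e1 := measureReal_sub_setIntegral_le (η := fun x => f x - g x) (hfin hAR) hK
      (hf.continuous.sub hg.continuous) hb fun x hx => by
        rw [(hf1 x).1 hx, (hg0 x).1 (Or.inl hx), sub_zero]
    have e2 := measureReal_sub_setIntegral_le (η := fun x => g x - f x) (hfin hBR) hL
      (hg.continuous.sub hf.continuous) (fun x => by rw [abs_sub_comm]; exact hb x) fun x hx => by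
        rw [(hg1 x).1 hx, (hf0 x).1 (Or.inl hx), sub_zero]
    have e3 : ∫ x in B, (g x - f x) = -∫ x in B, (f x - g x) := by
      rw [← integral_neg]; simp
    rw [e3] at e2
    linarith

theorem integrable_testForm_apply {p : ℕ} (α : TestForm p) (v : Fin p → Plane) :
    Integrable (fun x => α x v) := by
  set ev := ContinuousMultilinearMap.apply ℝ (fun _ : Fin p => Plane) ℝ v ∘L
      ContinuousAlternatingMap.toContinuousMultilinearMapCLM ℝ
  exact (ev.continuous.comp α.continuous).integrable_of_hasCompactSupport
    (α.hasCompactSupport.comp_left (map_zero ev))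

theorem topCurrent_sub_apply {F G : Set Plane} (hF : NullMeasurableSet F volume)
    (hG : NullMeasurableSet G volume) (α : TestForm 2) :
    (topCurrent F - topCurrent G) α =
      (∫ x in F \ G, α x stdFrame) - ∫ x in G \ F, α x stdFrame := by
  have hi := integrable_testForm_apply α stdFrame
  have h (F G : Set Plane) (hG : NullMeasurableSet G volume) : ∫ x in F, α x stdFrame =
      (∫ x in F ∩ G, α x stdFrame) + ∫ x in F \ G, α x stdFrame :=
    (integral_inter_add_sdiff₀ hG hi.integrableOn).symm
  rw [sub_apply, topCurrent_apply, topCurrent_apply, h F G hG, h G F hF,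
    inter_comm G F]
  ring

theorem mass_topCurrent_sub_le {F G : Set Plane} (hF : NullMeasurableSet F volume)
    (hG : NullMeasurableSet G volume) (hFf : volume (F \ G) ≠ ⊤) (hGf : volume (G \ F) ≠ ⊤) :
    mass (topCurrent F - topCurrent G) ≤ volume (F \ G) + volume (G \ F) := by
  refine iSup₂_le fun α hα => ?_
  rw [topCurrent_sub_apply hF hG]
  have hb (x : Plane) : ‖α x stdFrame‖ ≤ 1 := by
    refine ((α x).le_opNorm _).trans ?_
    simpa [stdFrame] using hα x
  have h1 := norm_setIntegral_le_of_norm_le_const (f := fun x => α x stdFrame) hFf.lt_top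
    fun x _ => hb x
  have h2 := norm_setIntegral_le_of_norm_le_const (f := fun x => α x stdFrame) hGf.lt_top
    fun x _ => hb x
  rw [← ENNReal.ofReal_toReal (ENNReal.add_ne_top.2 ⟨hFf, hGf⟩), ENNReal.toReal_add hFf hGf]
  refine ENNReal.ofReal_le_ofReal ?_
  rw [Real.norm_eq_abs, one_mul] at h1 h2
  linarith [(abs_le.1 h1).2, (abs_le.1 h2).1, measureReal_def (volume : Measure Plane) (F \ G),
    measureReal_def (volume : Measure Plane) (G \ F)]

/-- A one-form calibrating the difference of two sets, with an exact bound on its differential. -/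
theorem exists_calibration {F G : Set Plane} (hF : NullMeasurableSet F volume)
    (hG : NullMeasurableSet G volume) {R : ℝ} (hR : 0 ≤ R) (hFR : F \ G ⊆ Metric.ball 0 R)
    (hGR : G \ F ⊆ Metric.ball 0 R) {ε : ℝ} (hε : 0 < ε) :
    ∃ β : TestForm 1, (∀ x, ‖β x‖ ≤ 2 * R + 1) ∧ (∀ x, ‖extD 1 β x‖ ≤ 1) ∧
      volume.real (F \ G) + volume.real (G \ F) - ε ≤
        (topCurrent F - topCurrent G) (extD 1 β) := by
  obtain ⟨η, hη1, hηR, hη⟩ := exists_scalarTest_approx (hF.diff hG) (hG.diff hF)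
    disjoint_sdiff_sdiff hFR hGR hε
  -- A compactly supported $\beta$ has $\int d\beta=0$, so $\eta$ alone need not be a differential.
  -- A copy of $\eta$, translated by more than the diameter of the ball, is subtracted. The two
  -- supports are disjoint, so $|d\beta|\le1$ survives, and the copy does not meet the sets.
  set h : ℝ := 2 * R + 1 with hh
  have h0 : 0 ≤ h := by positivity
  obtain ⟨ψ, hψ1, hψ⟩ := exists_segment_average η (h • stdFrame 0) hη1
  have hv : ‖h • stdFrame 0‖ = h := by simp [stdFrame, norm_smul, abs_of_nonneg h0]
  have hd (x : Plane) : extD 1 (h • constForm (coordForm 1) ψ) x stdFrame =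
      η x - η (x - h • stdFrame 0) := by
    rw [extD_one_stdFrame, ← hψ x]
    have e0 : (fun y => (h • constForm (coordForm 1) ψ) y fun _ => stdFrame 0) = fun _ => 0 := by
      funext y
      change h • (constForm (coordForm 1) ψ) y (fun _ => stdFrame 0) = 0
      simp [stdFrame]
    have e1 : (fun y => (h • constForm (coordForm 1) ψ) y fun _ => stdFrame 1) =
        fun y => h • ψ y := by
      funext y
      change h • (constForm (coordForm 1) ψ) y (fun _ => stdFrame 1) = _
      simp [stdFrame]
    rw [e0, e1]
    have hdψ : DifferentiableAt ℝ ψ x := ψ.contDiff.differentiable (by simp) x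
    rw [fderiv_fun_const_smul hdψ]
    simp
  have htrans (x : Plane) (hx : η x ≠ 0) : η (x - h • stdFrame 0) = 0 := by
    refine hηR _ ?_
    have h1 : ‖x‖ < R := not_le.1 fun h => hx (hηR x h)
    have h2 := norm_sub_norm_le (h • stdFrame 0) x
    rw [norm_sub_rev, hv] at h2
    linarith
  refine ⟨h • constForm (coordForm 1) ψ, fun x => ?_, fun x => ?_, ?_⟩
  · change ‖h • (constForm (coordForm 1) ψ) x‖ ≤ h
    rw [norm_smul, constForm_apply, norm_smul, Real.norm_of_nonneg h0]
    refine mul_le_of_le_one_right h0 ?_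
    exact mul_le_one₀ (hψ1 x) (norm_nonneg _) (norm_coordForm_le 1)
  · refine (norm_le_abs_apply_stdFrame _).trans ?_
    rw [hd]
    by_cases hx : η x = 0
    · simpa [hx] using hη1 _
    · simpa [htrans x hx] using hη1 x
  · refine hη.trans_eq ?_
    rw [topCurrent_sub_apply hF hG]
    have key {A : Set Plane} (hA : NullMeasurableSet A volume) (hAR : A ⊆ Metric.ball 0 R) :
        ∫ x in A, η x = ∫ x in A, extD 1 (h • constForm (coordForm 1) ψ) x stdFrame := by
      refine setIntegral_congr_fun₀ hA fun x hx => ?_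
      simp only [hd]
      rw [hηR (x - _), sub_zero]
      have h1 : ‖x‖ < R := by simpa using hAR hx
      have h2 := norm_sub_norm_le (h • stdFrame 0) x
      rw [norm_sub_rev, hv] at h2
      linarith
    rw [key (hF.diff hG) hFR, key (hG.diff hF) hGR]

/-- Every filling of the boundary of a difference of sets has at least the mass of that difference,
and at small scales no partial filling is cheaper. -/
theorem measure_le_of_calibration {F G : Set Plane} (hF : NullMeasurableSet F volume)
    (hG : NullMeasurableSet G volume) {R : ℝ} (hR : 0 ≤ R) (hFR : F \ G ⊆ Metric.ball 0 R)
    (hGR : G \ F ⊆ Metric.ball 0 R) {m : ℝ≥0∞}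
    (h : ∀ β : TestForm 1, (∀ x, ‖β x‖ ≤ 2 * R + 1) → (∀ x, ‖extD 1 β x‖ ≤ 1) →
      ENNReal.ofReal ((topCurrent F - topCurrent G) (extD 1 β)) ≤ m) :
    volume (F \ G) + volume (G \ F) ≤ m := by
  have h1 : volume (F \ G) ≠ ⊤ := measure_ne_top_of_subset hFR measure_ball_lt_top.ne
  have h2 : volume (G \ F) ≠ ⊤ := measure_ne_top_of_subset hGR measure_ball_lt_top.ne
  refine ENNReal.le_of_forall_pos_le_add fun ε hε _ => ?_
  obtain ⟨β, hβ, hdβ, hc⟩ := exists_calibration hF hG hR hFR hGR (ε := ε) (by exact_mod_cast hε)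
  calc volume (F \ G) + volume (G \ F)
      = ENNReal.ofReal (volume.real (F \ G) + volume.real (G \ F)) := by
        rw [ENNReal.ofReal_add measureReal_nonneg measureReal_nonneg, ofReal_measureReal h1,
          ofReal_measureReal h2]
    _ ≤ ENNReal.ofReal ((topCurrent F - topCurrent G) (extD 1 β) + ε) :=
        ENNReal.ofReal_le_ofReal (by linarith)
    _ ≤ ENNReal.ofReal ((topCurrent F - topCurrent G) (extD 1 β)) + ENNReal.ofReal ε :=
        ENNReal.ofReal_add_le
    _ ≤ m + ε := by
        gcongr
        · exact h β hβ hdβ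
        · simp

/-- Currents with the same boundary agree on exact forms, and a calibration is only ever tested
through $d\beta$. -/
theorem measure_le_mass_of_boundary_eq {F G : Set Plane} (hF : NullMeasurableSet F volume)
    (hG : NullMeasurableSet G volume) {R : ℝ} (hR : 0 ≤ R) (hFR : F \ G ⊆ Metric.ball 0 R)
    (hGR : G \ F ⊆ Metric.ball 0 R) {Q : Current 2}
    (hQ : boundary Q = boundary (topCurrent F - topCurrent G)) :
    volume (F \ G) + volume (G \ F) ≤ mass Q := by
  refine measure_le_of_calibration hF hG hR hFR hGR fun β _ hdβ => ?_
  have : (topCurrent F - topCurrent G) (extD 1 β) = Q (extD 1 β) := (DFunLike.congr_fun hQ β).symm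
  rw [this]
  exact ofReal_le_mass Q hdβ

/-- With $T=[[F]]-[[G]]$, one has $\lambda T(d\beta)=(\partial T-\partial S)(\lambda\beta)+\lambda
S(d\beta)$. The condition on $\lambda$ gives $|\lambda\beta|\le1$, so the first term is at most
$M(\partial T-\partial S)$ and the second at most $\lambda M(S)$. -/
theorem measure_le_flatNorm {F G : Set Plane} (hF : NullMeasurableSet F volume)
    (hG : NullMeasurableSet G volume) {R : ℝ} (hR : 0 ≤ R) (hFR : F \ G ⊆ Metric.ball 0 R)
    (hGR : G \ F ⊆ Metric.ball 0 R) {lam : ℝ≥0} (hlam : lam * (2 * R + 1) ≤ 1) :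
    lam * (volume (F \ G) + volume (G \ F)) ≤
      flatNorm lam (boundary (topCurrent F - topCurrent G)) := by
  rcases eq_or_ne lam 0 with rfl | hl
  · simp
  refine le_iInf fun S => ?_
  set T := topCurrent F - topCurrent G
  have hl' : (lam : ℝ≥0∞) ≠ 0 := by simpa using hl
  rw [mul_comm, ← ENNReal.le_div_iff_mul_le (Or.inl hl') (Or.inl ENNReal.coe_ne_top)]
  refine measure_le_of_calibration hF hG hR hFR hGR fun β hβ hdβ => ?_
  rw [ENNReal.le_div_iff_mul_le (Or.inl hl') (Or.inl ENNReal.coe_ne_top)]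
  have e : T (extD 1 β) = (boundary T - boundary S) β + S (extD 1 β) := by
    simp [boundary]
  have hb (x : Plane) : ‖((lam : ℝ) • β) x‖ ≤ 1 := by
    change ‖(lam : ℝ) • β x‖ ≤ 1
    rw [norm_smul, NNReal.norm_eq]
    exact (mul_le_mul_of_nonneg_left (hβ x) lam.2).trans hlam
  calc ENNReal.ofReal (T (extD 1 β)) * lam
      ≤ (ENNReal.ofReal ((boundary T - boundary S) β) + ENNReal.ofReal (S (extD 1 β))) * lam := by
        rw [e]; gcongr; exact ENNReal.ofReal_add_le
    _ = ENNReal.ofReal ((boundary T - boundary S) ((lam : ℝ) • β)) +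
          lam * ENNReal.ofReal (S (extD 1 β)) := by
        rw [map_smul, smul_eq_mul, ENNReal.ofReal_mul (NNReal.coe_nonneg lam), ENNReal.ofReal_coe_nnreal]
        ring
    _ ≤ _ := by
        gcongr
        · exact ofReal_le_mass _ hb
        · exact ofReal_le_mass _ hdβ

theorem mass_zero {p : ℕ} : mass (0 : Current p) = 0 := by
  simp [mass]

theorem flatNorm_boundary_le {p : ℕ} (lam : ℝ≥0) (Q : Current (p + 1)) :
    flatNorm lam (boundary Q) ≤ lam * mass Q := by
  refine (iInf_le _ Q).trans ?_
  simp [mass_zero]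

theorem boundary_sub {p : ℕ} (S T : Current (p + 1)) :
    boundary (S - T) = boundary S - boundary T := by
  ext1 α
  simp [boundary]

/-! ### Restriction of currents to open sets. -/

/-- The product of a test function with a smooth function. -/
def smulTest {F : Type*} [NormedAddCommGroup F] [NormedSpace ℝ F] (g : Plane → ℝ)
    (hg : ContDiff ℝ ∞ g) (α : 𝓓((⊤ : TopologicalSpace.Opens Plane), F)) :
    𝓓((⊤ : TopologicalSpace.Opens Plane), F) :=
  ⟨fun x => g x • α x, hg.smul α.contDiff, α.hasCompactSupport.smul_left, by simp⟩

/-- The product of a test form with a smooth function. -/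
def smulForm {p : ℕ} (g : Plane → ℝ) (hg : ContDiff ℝ ∞ g) (α : TestForm p) : TestForm p :=
  smulTest g hg α

@[simp]
theorem smulForm_apply {p : ℕ} (g : Plane → ℝ) (hg : ContDiff ℝ ∞ g) (α : TestForm p)
    (x : Plane) : smulForm g hg α x = g x • α x := rfl

theorem exists_norm_testForm_le {p : ℕ} (α : TestForm p) : ∃ C : ℝ, ∀ x, ‖α x‖ ≤ C :=
  α.hasCompactSupport.exists_bound_of_continuous α.continuous

theorem measurable_testForm_apply {p : ℕ} (α : TestForm p) {ξ : Plane → Fin p → Plane}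
    (hξ : Measurable ξ) : Measurable fun x => α x (ξ x) := by
  have hc : Continuous fun q : Plane × (Fin p → Plane) => α q.1 q.2 := by
    have := α.continuous
    fun_prop
  exact hc.measurable.comp (measurable_id.prodMk hξ)

theorem abs_testForm_apply_le {p : ℕ} (α : TestForm p) {C : ℝ} (hC : ∀ x, ‖α x‖ ≤ C) (x : Plane)
    {v : Fin p → Plane} (hv : Orthonormal ℝ v) : |α x v| ≤ C := by
  refine ((α x).le_opNorm _).trans ?_
  simpa [hv.norm_eq_one] using hC x

theorem integrable_mul_testForm {p : ℕ} (α : TestForm p) {μ : Measure Plane} {m : Plane → ℝ}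
    {ξ : Plane → Fin p → Plane} (hm : Integrable m μ) (hξ : Measurable ξ)
    (ho : ∀ x, Orthonormal ℝ (ξ x)) : Integrable (fun x => m x * α x (ξ x)) μ := by
  obtain ⟨C, hC⟩ := exists_norm_testForm_le α
  exact hm.mul_bdd (measurable_testForm_apply α hξ).aestronglyMeasurable
    (Filter.Eventually.of_forall fun x => abs_testForm_apply_le α hC x (ho x))

/-- Dominated convergence recovers $T-R$ from values of $T$ alone, so nothing depends on the
representing measure chosen in `IsRestriction`. -/
theorem IsRestriction.tendsto_smulForm {p : ℕ} {T R : Current p} {U : Set Plane}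
    (h : IsRestriction T U R) (hU : MeasurableSet U) {χ : ℕ → Plane → ℝ}
    (hχ : ∀ n, ContDiff ℝ ∞ (χ n)) (hb : ∀ n x, |χ n x| ≤ 1)
    (hlim : ∀ x, Filter.Tendsto (fun n => χ n x) Filter.atTop (𝓝 (Uᶜ.indicator 1 x)))
    (α : TestForm p) :
    Filter.Tendsto (fun n => T (smulForm (χ n) (hχ n) α)) Filter.atTop (𝓝 (T α - R α)) := by
  obtain ⟨μ, m, ξ, hμ, hm, hξ, ho, hT, hR⟩ := h
  have hi := integrable_mul_testForm α hm hξ ho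
  have e : T α - R α = ∫ x, Uᶜ.indicator 1 x * (m x * α x (ξ x)) ∂μ := by
    rw [hT, hR, ← integral_add_compl hU hi, add_sub_cancel_left, ← integral_indicator hU.compl]
    congr 1 with x
    by_cases hx : x ∈ Uᶜ
    · rw [indicator_of_mem hx, indicator_of_mem hx]; simp
    · rw [indicator_of_notMem hx, indicator_of_notMem hx]; simp
  rw [e]
  simp_rw [hT]
  refine tendsto_integral_of_dominated_convergence (fun x => |m x * α x (ξ x)|) (fun n => ?_)
    hi.abs (fun n => ?_) ?_
  · exact (integrable_mul_testForm _ hm hξ ho).aestronglyMeasurable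
  · refine Filter.Eventually.of_forall fun x => ?_
    simp only [smulForm_apply, ContinuousAlternatingMap.smul_apply, smul_eq_mul, Real.norm_eq_abs]
    rw [mul_left_comm, abs_mul]
    exact mul_le_of_le_one_left (abs_nonneg _) (hb n x)
  · refine Filter.Eventually.of_forall fun x => ?_
    simp only [smulForm_apply, ContinuousAlternatingMap.smul_apply, smul_eq_mul]
    simp_rw [mul_left_comm (m x)]
    exact (hlim x).mul_const _

/-- Currents that agree away from $K$ have the same part outside $U\supseteq K$; hence
$T_1-R_1=T_2-R_2$. -/
theorem IsRestriction.sub_eq_sub {p : ℕ} {T₁ T₂ R₁ R₂ : Current p} {U K : Set Plane}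
    (h₁ : IsRestriction T₁ U R₁) (h₂ : IsRestriction T₂ U R₂) (hU : IsOpen U) (hK : IsClosed K)
    (hKU : K ⊆ U) (heq : ∀ α : TestForm p, tsupport α ⊆ Kᶜ → T₁ α = T₂ α) :
    R₁ - R₂ = T₁ - T₂ := by
  obtain ⟨V, hVo, hKV, hVU⟩ := normal_exists_closure_subset hK hU hKU
  obtain ⟨k, hk, hk01, hk0, hk1⟩ := exists_contDiff_zero_iff_one_iff isClosed_closure
    hU.isClosed_compl (disjoint_compl_right.mono_left hVU)
  obtain ⟨g, hg, hg01, hg0, -⟩ := exists_contDiff_zero_iff_one_iff hU.isClosed_compl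
    isClosed_empty (disjoint_empty _)
  -- Since `k` vanishes near `K`, `T₁` and `T₂` agree on forms cut off by `χ n`. Off `U` both
  -- factors are 1, and inside `U` one has `g > 0`, so the powers tend to 0.
  set χ : ℕ → Plane → ℝ := fun n x => k x * (1 - g x) ^ n
  have hχ (n : ℕ) : ContDiff ℝ ∞ (χ n) := hk.mul ((contDiff_const.sub hg).pow n)
  have hb (n : ℕ) (x : Plane) : |χ n x| ≤ 1 := by
    have h1 := hk01 x
    have h2 := hg01 x
    have h3 : (1 - g x) ^ n ≤ 1 := pow_le_one₀ (by linarith [h2.2]) (by linarith [h2.1])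
    have h4 : 0 ≤ (1 - g x) ^ n := pow_nonneg (by linarith [h2.2]) n
    rw [abs_of_nonneg (mul_nonneg h1.1 h4)]
    exact mul_le_one₀ h1.2 h4 h3
  have hlim (x : Plane) :
      Filter.Tendsto (fun n => χ n x) Filter.atTop (𝓝 (Uᶜ.indicator 1 x)) := by
    by_cases hx : x ∈ Uᶜ
    · simp [χ, indicator_of_mem hx, (hk1 x).1 hx, (hg0 x).1 hx]
    · have h2 := hg01 x
      have h3 : 0 < g x := lt_of_le_of_ne h2.1 fun h => hx ((hg0 x).2 h.symm)
      rw [indicator_of_notMem hx]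
      simpa using (tendsto_pow_atTop_nhds_zero_of_lt_one (by linarith [h2.2] : 0 ≤ 1 - g x)
        (by linarith)).const_mul (k x)
  ext1 α
  have t₁ := h₁.tendsto_smulForm hU.measurableSet hχ hb hlim α
  have t₂ := h₂.tendsto_smulForm hU.measurableSet hχ hb hlim α
  have hs (n : ℕ) : T₁ (smulForm (χ n) (hχ n) α) = T₂ (smulForm (χ n) (hχ n) α) := by
    refine heq _ fun x hx hxK => ?_
    have : x ∈ closure Vᶜ := by
      have hsub : Function.support (smulForm (χ n) (hχ n) α) ⊆ Vᶜ := fun y hy hyV =>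
        hy (by simp [χ, (hk0 y).1 (subset_closure hyV)])
      exact closure_mono hsub hx
    rw [closure_compl, hVo.interior_eq] at this
    exact this (hKV hxK)
  simp_rw [hs] at t₁
  have := tendsto_nhds_unique t₁ t₂
  simp only [sub_apply]
  linarith

theorem tsupport_extD_subset {p : ℕ} (α : TestForm p) : tsupport (extD p α) ⊆ tsupport α := by
  refine closure_minimal (fun x hx => ?_) (isClosed_tsupport _)
  by_contra h
  refine hx ?_
  have h0 : fderiv ℝ α x = 0 := by
    have := tsupport_fderiv_subset (𝕜 := ℝ) (f := α)
    exact image_eq_zero_of_notMem_tsupport fun h' => h (this h')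
  ext v
  rw [extD_apply, extDeriv, h0, ContinuousAlternatingMap.alternatizeUncurryFin_apply]
  simp

/-- Both sets agree with $E$, hence with each other, off $U_1\cup U_2$, so their boundaries coincide
on forms supported away from the closures of $U_1$ and $U_2$. -/
theorem sub_eq_boundary_of_isRestriction {E F G U U₁ U₂ : Set Plane} {S T : Current 1}
    (hF : NullMeasurableSet F volume) (hG : NullMeasurableSet G volume) (hU : IsOpen U)
    (hS : IsRestriction (boundary (topCurrent F)) U S)
    (hT : IsRestriction (boundary (topCurrent G)) U T)
    (hU₁ : closure U₁ ⊆ U) (hU₂ : closure U₂ ⊆ U) (hEF : E \ U₁ = F \ U₁) (hEG : E \ U₂ = G \ U₂) :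
    S - T = boundary (topCurrent F - topCurrent G) := by
  rw [boundary_sub]
  refine hS.sub_eq_sub hT hU (isClosed_closure.union isClosed_closure) (union_subset hU₁ hU₂)
    fun α hα => ?_
  have h : (topCurrent F - topCurrent G) (extD 1 α) = 0 := by
    have key {A : Set Plane} (hA : NullMeasurableSet A volume) (h : A ⊆ U₁ ∪ U₂) :
        ∫ x in A, extD 1 α x stdFrame = 0 := by
      rw [setIntegral_congr_fun₀ hA (g := fun _ => (0 : ℝ)) fun x hx => ?_]
      · simp
      · have : extD 1 α x = 0 := image_eq_zero_of_notMem_tsupport fun hx' =>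
          hα (tsupport_extD_subset α hx')
            ((union_subset_union subset_closure subset_closure) (h hx))
        simp [this]
    rw [topCurrent_sub_apply hF hG, key (hF.diff hG), key (hG.diff hF), sub_zero]
    · intro x hx
      by_contra hn
      have h2 : x ∈ E \ U₂ := hEG ▸ ⟨hx.1, fun h => hn (Or.inr h)⟩
      exact hx.2 (hEF.subset ⟨h2.1, fun h => hn (Or.inl h)⟩).1
    · intro x hx
      by_contra hn
      have h2 : x ∈ E \ U₁ := hEF ▸ ⟨hx.1, fun h => hn (Or.inl h)⟩
      exact hx.2 (hEG.subset ⟨h2.1, fun h => hn (Or.inr h)⟩).1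
  rw [sub_apply] at h
  exact sub_eq_zero.1 h

/-! ### Length of graphs and the area formula. -/

/-- The normalizing factor does not depend on the space; on the unit interval of $\mathbb R$ both
measures equal 1. -/
theorem euclideanHausdorffMeasure_one (X : Type*) [EMetricSpace X] [MeasurableSpace X]
    [BorelSpace X] : (μHE[1] : Measure X) = μH[1] := by
  have h1 : (μHE[1] : Measure ℝ) = volume := by
    have := InnerProductSpace.euclideanHausdorffMeasure_eq_volume (V := ℝ)
    rwa [Module.finrank_self] at this
  have h2 := Measure.euclideanHausdorffMeasure_def (X := ℝ) 1
  rw [Measure.euclideanHausdorffMeasure_def]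
  generalize Measure.addHaarScalarFactor (volume : Measure (EuclideanSpace ℝ (Fin 1)))
    μH[((1 : ℕ) : ℝ)] = c
    at h2 ⊢
  rw [h1, Nat.cast_one, hausdorffMeasure_real] at h2
  have h3 := congrArg (fun μ : Measure ℝ => μ (Icc 0 1)) h2
  have h4 : c = 1 := by
    simp only [Measure.smul_apply, Real.volume_Icc, sub_zero, ENNReal.ofReal_one] at h3
    rw [ENNReal.smul_def, smul_eq_mul, mul_one] at h3
    exact_mod_cast h3.symm
  rw [h4, one_smul, Nat.cast_one]

/-- The parametrization of the graph of `f`. -/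
def graphMap (f : ℝ → ℝ) (x : ℝ) : Plane := !₂[x, f x]

@[simp] theorem graphMap_zero (f : ℝ → ℝ) (x : ℝ) : graphMap f x 0 = x := rfl

@[simp] theorem graphMap_one (f : ℝ → ℝ) (x : ℝ) : graphMap f x 1 = f x := rfl

theorem eq_graphMap {f : ℝ → ℝ} {q : Plane} (h : q 1 = f (q 0)) : q = graphMap f (q 0) := by
  ext i
  fin_cases i
  · rfl
  · exact h

theorem graphMap_injective (f : ℝ → ℝ) : Function.Injective (graphMap f) := fun x y h => by
  simpa using congrArg (fun q : Plane => q 0) h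

theorem image_graphMap (f : ℝ → ℝ) (s : Set ℝ) :
    graphMap f '' s = {q | q 0 ∈ s ∧ q 1 = f (q 0)} := by
  ext q
  constructor
  · rintro ⟨x, hx, rfl⟩
    exact ⟨hx, rfl⟩
  · rintro ⟨hx, h⟩
    exact ⟨q 0, hx, (eq_graphMap h).symm⟩

theorem graphSet_eq_image (f : ℝ → ℝ) : graphSet f = graphMap f '' Icc 0 1 :=
  (image_graphMap f _).symm

theorem continuous_graphMap {f : ℝ → ℝ} (hf : Continuous f) : Continuous (graphMap f) := by
  unfold graphMap
  fun_prop

theorem measurableEmbedding_graphMap {f : ℝ → ℝ} (hf : Continuous f) :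
    MeasurableEmbedding (graphMap f) :=
  (continuous_graphMap hf).measurableEmbedding (graphMap_injective f)

/-- A Lipschitz function which is strictly differentiable off a countable set, so that its graph
is an almost everywhere `C¹` curve. -/
structure IsProfile (f : ℝ → ℝ) : Prop where
  lipschitz : ∃ K, LipschitzWith K f
  strict : ∃ s : Set ℝ, s.Countable ∧ ∀ x ∉ s, HasStrictDerivAt f (deriv f x) x

namespace IsProfile

theorem continuous {f : ℝ → ℝ} (hf : IsProfile f) : Continuous f :=
  hf.lipschitz.choose_spec.continuous

theorem ae_hasStrictDerivAt {f : ℝ → ℝ} (hf : IsProfile f) :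
    ∀ᵐ x, HasStrictDerivAt f (deriv f x) x := by
  obtain ⟨s, hs, h⟩ := hf.strict
  filter_upwards [compl_mem_ae_iff.2 (hs.measure_zero volume)] with x hx using h x hx

end IsProfile

/-- The length element of the graph of `f`. -/
def speed (f : ℝ → ℝ) (x : ℝ) : ℝ := Real.sqrt (1 + deriv f x ^ 2)

theorem speed_pos (f : ℝ → ℝ) (x : ℝ) : 0 < speed f x := by
  unfold speed; positivity

theorem measurable_speed (f : ℝ → ℝ) : Measurable (speed f) := by
  have := measurable_deriv f
  unfold speed
  fun_prop

theorem norm_graphTangent (f : ℝ → ℝ) (x : ℝ) : ‖(!₂[1, deriv f x] : Plane)‖ = speed f x := by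
  simp [EuclideanSpace.norm_eq, speed]

theorem LipschitzWith.graphMap {f : ℝ → ℝ} {K : ℝ≥0} (hf : LipschitzWith K f) :
    LipschitzWith (1 + K) (graphMap f) := by
  refine LipschitzWith.of_dist_le_mul fun x y => ?_
  have h := hf.dist_le_mul x y
  rw [EuclideanSpace.dist_eq]
  refine Real.sqrt_le_iff.2 ⟨by positivity, ?_⟩
  simp only [Fin.sum_univ_two, graphMap_zero, graphMap_one, NNReal.coe_add, NNReal.coe_one]
  have h0 : 0 ≤ dist (f x) (f y) := dist_nonneg
  have h1 : 0 ≤ dist x y := dist_nonneg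
  have h2 : 0 ≤ (K : ℝ) := K.2
  nlinarith [mul_nonneg h2 h1, mul_nonneg (mul_nonneg h2 h1) h1]

theorem hasStrictDerivAt_graphMap {f : ℝ → ℝ} {f' x : ℝ} (h : HasStrictDerivAt f f' x) :
    HasStrictDerivAt (graphMap f) !₂[1, f'] x := by
  have h1 : HasStrictDerivAt (fun x => (![x, f x] : Fin 2 → ℝ)) ![1, f'] x := by
    refine hasStrictDerivAt_pi.2 fun i => ?_
    fin_cases i
    · exact hasStrictDerivAt_id x
    · exact h
  exact ((PiLp.continuousLinearEquiv 2 ℝ (fun _ : Fin 2 => ℝ)).symm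
    : (Fin 2 → ℝ) →L[ℝ] Plane).hasStrictFDerivAt.comp_hasStrictDerivAt x h1

/-- Near a point of strict differentiability a curve stretches lengths almost uniformly. -/
theorem HasStrictDerivAt.exists_ball_norm_sub {E : Type*} [NormedAddCommGroup E] [NormedSpace ℝ E]
    {γ : ℝ → E} {v : E} {x : ℝ} (h : HasStrictDerivAt γ v x) {ε : ℝ} (hε : 0 < ε) :
    ∃ δ > 0, ∀ y ∈ Metric.ball x δ, ∀ z ∈ Metric.ball x δ,
      (‖v‖ - ε) * |y - z| ≤ ‖γ y - γ z‖ ∧ ‖γ y - γ z‖ ≤ (‖v‖ + ε) * |y - z| := by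
  have h1 := h.hasStrictFDerivAt.isLittleO.def hε
  obtain ⟨δ, hδ, h2⟩ := Metric.eventually_nhds_iff_ball.1 h1
  refine ⟨δ, hδ, fun y hy z hz => ?_⟩
  have h3 := h2 (y, z) (by rw [← ball_prod_same]; exact ⟨hy, hz⟩)
  simp only [ContinuousLinearMap.toSpanSingleton_apply] at h3
  have e : ‖(y - z) • v‖ = ‖v‖ * |y - z| := by rw [norm_smul, Real.norm_eq_abs, mul_comm]
  have h4 := norm_sub_norm_le (γ y - γ z) ((y - z) • v)
  have h5 := norm_sub_norm_le ((y - z) • v) (γ y - γ z)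
  rw [norm_sub_rev ((y - z) • v)] at h5
  rw [Real.norm_eq_abs] at h3
  constructor <;> nlinarith

/-- The upper bound is the Lipschitz bound for $\gamma$; the lower one is that for its inverse on
the image, which is $a^{-1}$-Lipschitz. -/
theorem hausdorffMeasure_image_closedBall {γ : ℝ → Plane} {x r a b : ℝ} (ha : 0 < a) (hb : 0 ≤ b)
    (h : ∀ y ∈ Metric.closedBall x r, ∀ z ∈ Metric.closedBall x r,
      a * |y - z| ≤ ‖γ y - γ z‖ ∧ ‖γ y - γ z‖ ≤ b * |y - z|) :
    ENNReal.ofReal a * volume (Metric.closedBall x r) ≤ μHE[1] (γ '' Metric.closedBall x r) ∧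
      μHE[1] (γ '' Metric.closedBall x r) ≤
        ENNReal.ofReal b * volume (Metric.closedBall x r) := by
  rw [euclideanHausdorffMeasure_one, ← hausdorffMeasure_real]
  set B := Metric.closedBall x r
  constructor
  · obtain ⟨σ, hσ⟩ : ∃ σ : Plane → ℝ, ∀ y ∈ B, σ (γ y) = y := by
      have hinj : InjOn γ B := fun y hy z hz hyz => by
        have := (h y hy z hz).1
        rw [hyz, sub_self, norm_zero] at this
        have : |y - z| ≤ 0 := by nlinarith [abs_nonneg (y - z)]
        exact sub_eq_zero.1 (abs_nonpos_iff.1 this)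
      exact ⟨Function.invFunOn γ B, fun y hy => hinj.leftInvOn_invFunOn hy⟩
    have hl : LipschitzOnWith (Real.toNNReal a⁻¹) σ (γ '' B) := by
      refine LipschitzOnWith.of_dist_le_mul ?_
      rintro _ ⟨y, hy, rfl⟩ _ ⟨z, hz, rfl⟩
      rw [hσ y hy, hσ z hz, Real.coe_toNNReal _ (inv_nonneg.2 ha.le), Real.dist_eq, dist_eq_norm,
        inv_mul_eq_div, le_div_iff₀ ha, mul_comm]
      exact (h y hy z hz).1
    have h1 := hl.hausdorffMeasure_image_le (d := 1) zero_le_one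
    have h2 : σ '' (γ '' B) = B := by
      rw [image_image]
      exact (image_congr hσ).trans (image_id _)
    rw [h2, ENNReal.rpow_one] at h1
    calc ENNReal.ofReal a * μH[1] B
        ≤ ENNReal.ofReal a * (ENNReal.ofReal a⁻¹ * μH[1] (γ '' B)) := by gcongr; exact h1
      _ = μH[1] (γ '' B) := by
        rw [← mul_assoc, ← ENNReal.ofReal_mul ha.le, mul_inv_cancel₀ ha.ne', ENNReal.ofReal_one,
          one_mul]
  · have hl : LipschitzOnWith (Real.toNNReal b) γ B := by
      refine LipschitzOnWith.of_dist_le_mul fun y hy z hz => ?_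
      rw [Real.coe_toNNReal _ hb, Real.dist_eq, dist_eq_norm]
      exact (h y hy z hz).2
    simpa [ENNReal.ofReal] using hl.hausdorffMeasure_image_le (d := 1) zero_le_one

/-- Strict differentiability makes $\gamma$ bi-Lipschitz on small balls with constants
$\|v\|\pm\varepsilon$. -/
theorem tendsto_measure_image_closedBall_div {γ : ℝ → Plane} {v : Plane} {x : ℝ}
    (h : HasStrictDerivAt γ v x) (hv : v ≠ 0) :
    Filter.Tendsto (fun r => μHE[1] (γ '' Metric.closedBall x r) / volume (Metric.closedBall x r))
      (𝓝[>] 0) (𝓝 (ENNReal.ofReal ‖v‖)) := by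
  have hv' : 0 < ‖v‖ := norm_pos_iff.2 hv
  have key (ε : ℝ) (hε : 0 < ε) (hεv : ε < ‖v‖) : ∀ᶠ r in 𝓝[>] (0 : ℝ),
      ENNReal.ofReal (‖v‖ - ε) ≤
          μHE[1] (γ '' Metric.closedBall x r) / volume (Metric.closedBall x r) ∧
        μHE[1] (γ '' Metric.closedBall x r) / volume (Metric.closedBall x r) ≤
          ENNReal.ofReal (‖v‖ + ε) := by
    obtain ⟨δ, hδ, hb⟩ := HasStrictDerivAt.exists_ball_norm_sub h hε
    filter_upwards [Ioo_mem_nhdsGT hδ] with r hr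
    have hsub : Metric.closedBall x r ⊆ Metric.ball x δ := Metric.closedBall_subset_ball hr.2
    have h0 : volume (Metric.closedBall x r) ≠ 0 :=
      (Metric.measure_closedBall_pos volume x hr.1).ne'
    have ht : volume (Metric.closedBall x r) ≠ ⊤ := measure_closedBall_lt_top.ne
    have := hausdorffMeasure_image_closedBall (r := r) (sub_pos.2 hεv) (by positivity)
      fun y hy z hz => hb y (hsub hy) z (hsub hz)
    rw [ENNReal.le_div_iff_mul_le (Or.inl h0) (Or.inl ht),
      ENNReal.div_le_iff_le_mul (Or.inl h0) (Or.inl ht)]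
    exact this
  have c1 : Filter.Tendsto (fun ε : ℝ => ENNReal.ofReal (‖v‖ - ε)) (𝓝[>] 0)
      (𝓝 (ENNReal.ofReal ‖v‖)) := by
    refine tendsto_nhdsWithin_of_tendsto_nhds (ENNReal.tendsto_ofReal ?_)
    simpa using (tendsto_const_nhds (x := ‖v‖)).sub (Filter.tendsto_id (α := ℝ) (x := 𝓝 0))
  have c2 : Filter.Tendsto (fun ε : ℝ => ENNReal.ofReal (‖v‖ + ε)) (𝓝[>] 0)
      (𝓝 (ENNReal.ofReal ‖v‖)) := by
    refine tendsto_nhdsWithin_of_tendsto_nhds (ENNReal.tendsto_ofReal ?_)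
    simpa using (tendsto_const_nhds (x := ‖v‖)).add (Filter.tendsto_id (α := ℝ) (x := 𝓝 0))
  rw [tendsto_order]
  constructor
  · intro a ha
    obtain ⟨ε, h1, h2⟩ := ((c1.eventually (lt_mem_nhds ha)).and (Ioo_mem_nhdsGT hv')).exists
    filter_upwards [key ε h2.1 h2.2] with r hr using h1.trans_le hr.1
  · intro a ha
    obtain ⟨ε, h1, h2⟩ := ((c2.eventually (gt_mem_nhds ha)).and (Ioo_mem_nhdsGT hv')).exists
    filter_upwards [key ε h2.1 h2.2] with r hr using hr.2.trans_lt h1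

/-- Area formula for graphs. -/
theorem comap_graphMap {f : ℝ → ℝ} (hf : IsProfile f) :
    (μHE[1] : Measure Plane).comap (graphMap f) =
      volume.withDensity fun x => ENNReal.ofReal (speed f x) := by
  have he := measurableEmbedding_graphMap hf.continuous
  set ν := (μHE[1] : Measure Plane).comap (graphMap f) with hν
  have hval (s : Set ℝ) : ν s = μHE[1] (graphMap f '' s) := he.comap_apply _ s
  obtain ⟨K, hK⟩ := hf.lipschitz
  have hle (s : Set ℝ) : ν s ≤ (1 + K : ℝ≥0) * volume s := by
    rw [hval, euclideanHausdorffMeasure_one, ← hausdorffMeasure_real]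
    simpa using (LipschitzWith.graphMap hK).hausdorffMeasure_image_le (d := 1) zero_le_one s
  have hac : ν ≪ volume := Measure.AbsolutelyContinuous.mk fun s _ hs => by
    simpa [hs] using hle s
  have : IsLocallyFiniteMeasure ν := ⟨fun x => ⟨Metric.ball x 1, Metric.ball_mem_nhds x one_pos,
    (hle _).trans_lt (ENNReal.mul_lt_top ENNReal.coe_lt_top measure_ball_lt_top)⟩⟩
  -- The Radon–Nikodym density is almost everywhere the limit of ratios over shrinking balls, which
  -- is the speed.
  rw [← Measure.withDensity_rnDeriv_eq ν volume hac]
  refine withDensity_congr_ae ?_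
  filter_upwards [Besicovitch.ae_tendsto_rnDeriv ν volume, hf.ae_hasStrictDerivAt] with x h1 h2
  have h3 := tendsto_measure_image_closedBall_div (hasStrictDerivAt_graphMap h2)
    (norm_pos_iff.1 (by rw [norm_graphTangent]; exact speed_pos f x))
  rw [norm_graphTangent] at h3
  simp_rw [hval] at h1
  exact tendsto_nhds_unique h1 h3

theorem setIntegral_image_graphMap {f : ℝ → ℝ} (hf : IsProfile f) {s : Set ℝ}
    (hs : MeasurableSet s) (u : Plane → ℝ) :
    ∫ q in graphMap f '' s, u q ∂μHE[1] = ∫ x in s, speed f x * u (graphMap f x) := by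
  have he := measurableEmbedding_graphMap hf.continuous
  have h1 : (μHE[1] : Measure Plane).restrict (graphMap f '' s) =
      (((μHE[1] : Measure Plane).comap (graphMap f)).restrict s).map (graphMap f) := by
    rw [he.restrict_comap, he.map_comap, Measure.restrict_restrict he.measurableSet_range,
      inter_eq_right.2 (image_subset_range _ _)]
  rw [h1, he.integral_map, comap_graphMap hf, restrict_withDensity hs]
  change ∫ x, u (graphMap f x) ∂((volume.restrict s).withDensity
    fun x => ((speed f x).toNNReal : ℝ≥0∞)) = _
  rw [integral_withDensity_eq_integral_smul (measurable_speed f).real_toNNReal]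
  refine integral_congr_ae (Filter.Eventually.of_forall fun x => ?_)
  simp [NNReal.smul_def, Real.coe_toNNReal _ (speed_pos f x).le]

/-! ### Graph currents and their boundaries. -/

theorem norm_graphOrientation (f : ℝ → ℝ) (q : Plane) : ‖graphOrientation f q‖ = 1 := by
  have h : ‖(!₂[-1, -deriv f (q 0)] : Plane)‖ = speed f (q 0) := by
    simp [EuclideanSpace.norm_eq, speed]
  rw [graphOrientation, norm_smul, h, norm_inv, Real.norm_of_nonneg (Real.sqrt_nonneg _)]
  exact inv_mul_cancel₀ (speed_pos f (q 0)).ne'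

theorem measurable_graphOrientation (f : ℝ → ℝ) : Measurable (graphOrientation f) := by
  have h1 : Measurable fun q : Plane => deriv f (q 0) := (measurable_deriv f).comp (by fun_prop)
  have h2 : Measurable fun q : Plane => (!₂[-1, -deriv f (q 0)] : Plane) := by
    refine (WithLp.measurable_toLp 2 (Fin 2 → ℝ)).comp (measurable_pi_iff.2 fun i => ?_)
    fin_cases i
    · exact measurable_const
    · exact h1.neg
  exact (by fun_prop : Measurable fun q : Plane =>
    (Real.sqrt (1 + deriv f (q 0) ^ 2))⁻¹).smul h2

theorem orthonormal_of_norm_eq_one {v : Plane} (hv : ‖v‖ = 1) :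
    Orthonormal ℝ (fun _ : Fin 1 => v) := by
  refine ⟨fun _ => hv, fun i j hij => (hij (Subsingleton.elim i j)).elim⟩

theorem measurableSet_image_graphMap {f : ℝ → ℝ} (hf : Continuous f) {s : Set ℝ}
    (hs : MeasurableSet s) : MeasurableSet (graphMap f '' s) :=
  (measurableEmbedding_graphMap hf).measurableSet_image.2 hs

theorem measurableSet_graphSet {f : ℝ → ℝ} (hf : Continuous f) : MeasurableSet (graphSet f) := by
  rw [graphSet_eq_image]
  exact measurableSet_image_graphMap hf measurableSet_Icc

theorem measure_graphSet_lt_top {f : ℝ → ℝ} (hf : IsProfile f) :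
    (μHE[1] : Measure Plane) (graphSet f) < ⊤ := by
  obtain ⟨K, hK⟩ := hf.lipschitz
  rw [graphSet_eq_image, euclideanHausdorffMeasure_one]
  refine ((LipschitzWith.graphMap hK).hausdorffMeasure_image_le (d := 1) zero_le_one _).trans_lt ?_
  rw [hausdorffMeasure_real]
  simp

/-- The oriented graph of `f` over `[0,1]` as a current. -/
def graphCurrent (f : ℝ → ℝ) : Current 1 :=
  TestFunction.integralAgainstBilinCLM
    ((ContinuousAlternatingMap.ofSubsingletonLIE (𝕜 := ℝ) (E := Plane) (F := ℝ) (0 : Fin 1)).symm :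
      (Plane [⋀^Fin 1]→L[ℝ] ℝ) →L[ℝ] Plane →L[ℝ] ℝ)
    (μHE[1].restrict (graphSet f)) (graphOrientation f)

theorem graphCurrent_apply {f : ℝ → ℝ} (hf : IsProfile f) (α : TestForm 1) :
    graphCurrent f α = ∫ q in graphSet f, α q (fun _ => graphOrientation f q) ∂μHE[1] := by
  have : IsFiniteMeasure ((μHE[1] : Measure Plane).restrict (graphSet f)) :=
    ⟨by simpa using measure_graphSet_lt_top hf⟩
  have hi : Integrable (graphOrientation f) (μHE[1].restrict (graphSet f)) :=
    Integrable.of_bound (measurable_graphOrientation f).aestronglyMeasurable 1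
      (Filter.Eventually.of_forall fun q => (norm_graphOrientation f q).le)
  rw [graphCurrent, TestFunction.integralAgainstBilinCLM_eq_integral
    (hi.locallyIntegrable.locallyIntegrableOn _)]
  refine integral_congr_ae (Filter.Eventually.of_forall fun q => ?_)
  simp only
  set ℓ := (ContinuousAlternatingMap.ofSubsingletonLIE (𝕜 := ℝ) (E := Plane) (F := ℝ) (0 : Fin 1)).symm (α q) with hℓ
  have h : α q = ContinuousAlternatingMap.ofSubsingletonLIE (𝕜 := ℝ) (E := Plane) (F := ℝ) (0 : Fin 1) ℓ := by
    rw [hℓ, LinearIsometryEquiv.apply_symm_apply]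
  rw [h]
  rfl

theorem isGraphCurrent_graphCurrent {f : ℝ → ℝ} (hf : IsProfile f) :
    IsGraphCurrent f (graphCurrent f) := graphCurrent_apply hf

/-- The length element cancels the normalization of the unit tangent; the sign appears because
graphs are oriented leftwards. -/
theorem setIntegral_graphOrientation {f : ℝ → ℝ} (hf : IsProfile f) {s : Set ℝ}
    (hs : MeasurableSet s) (α : TestForm 1) :
    ∫ q in graphMap f '' s, α q (fun _ => graphOrientation f q) ∂μHE[1] =
      -∫ x in s, α (graphMap f x) (fun _ => !₂[1, deriv f x]) := by
  rw [setIntegral_image_graphMap hf hs, ← integral_neg]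
  refine integral_congr_ae (Filter.Eventually.of_forall fun x => ?_)
  have h : (fun _ : Fin 1 => graphOrientation f (graphMap f x)) =
      fun i => (fun _ : Fin 1 => -(speed f x)⁻¹) i • (fun _ : Fin 1 => (!₂[1, deriv f x] : Plane)) i := by
    funext _
    ext j
    fin_cases j <;> simp [graphOrientation, speed]
  simp only
  rw [h, ContinuousAlternatingMap.map_smul_univ]
  have := (speed_pos f x).ne'
  simp
  field_simp

theorem graphCurrent_eq_integral {f : ℝ → ℝ} (hf : IsProfile f) (α : TestForm 1) :
    graphCurrent f α =
      -∫ x in (0 : ℝ)..1, α (graphMap f x) (fun _ => !₂[1, deriv f x]) := by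
  rw [graphCurrent_apply hf, graphSet_eq_image, setIntegral_graphOrientation hf measurableSet_Icc,
    integral_Icc_eq_integral_Ioc, intervalIntegral.integral_of_le zero_le_one]

theorem measurable_graphTangent (f : ℝ → ℝ) :
    Measurable fun x => (!₂[1, deriv f x] : Plane) := by
  refine (WithLp.measurable_toLp 2 (Fin 2 → ℝ)).comp (measurable_pi_iff.2 fun i => ?_)
  fin_cases i
  · exact measurable_const
  · exact measurable_deriv f

theorem IsProfile.exists_speed_le {f : ℝ → ℝ} (hf : IsProfile f) : ∃ C, ∀ x, speed f x ≤ C := by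
  obtain ⟨K, hK⟩ := hf.lipschitz
  refine ⟨Real.sqrt (1 + K ^ 2), fun x => Real.sqrt_le_sqrt ?_⟩
  have := norm_deriv_le_of_lipschitz hK (x₀ := x)
  rw [Real.norm_eq_abs] at this
  have := pow_le_pow_left₀ (abs_nonneg _) this 2
  rw [sq_abs] at this
  linarith

theorem intervalIntegrable_testForm_graph {f : ℝ → ℝ} (hf : IsProfile f) (α : TestForm 1)
    (a b : ℝ) :
    IntervalIntegrable (fun x => α (graphMap f x) (fun _ => !₂[1, deriv f x])) volume a b := by
  obtain ⟨C, hC⟩ := exists_norm_testForm_le α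
  obtain ⟨D, hD⟩ := hf.exists_speed_le
  have hm : Measurable fun x => α (graphMap f x) (fun _ : Fin 1 => (!₂[1, deriv f x] : Plane)) := by
    have hc : Continuous fun q : Plane × (Fin 1 → Plane) => α q.1 q.2 := by
      have := α.continuous
      fun_prop
    exact hc.measurable.comp ((continuous_graphMap hf.continuous).measurable.prodMk
      (measurable_pi_iff.2 fun _ => measurable_graphTangent f))
  refine (intervalIntegrable_const (c := C * D)).mono_fun hm.aestronglyMeasurable
    (Filter.Eventually.of_forall fun x => ?_)
  refine ((α (graphMap f x)).le_opNorm _).trans ((?_ : _ ≤ C * D).trans (le_abs_self _))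
  simp only [Finset.univ_unique, Finset.prod_const, Finset.card_singleton, pow_one,
    norm_graphTangent]
  exact mul_le_mul (hC _) (hD x) (speed_pos f x).le ((norm_nonneg _).trans (hC 0))

theorem boundary_graphCurrent_apply {f : ℝ → ℝ} (hf : IsProfile f) (φ : TestForm 0) :
    boundary (graphCurrent f) φ = φ (graphMap f 0) 0 - φ (graphMap f 1) 0 := by
  change graphCurrent f (extD 0 φ) = _
  rw [graphCurrent_eq_integral hf]
  set ev := ContinuousMultilinearMap.apply ℝ (fun _ : Fin 0 => Plane) ℝ 0 ∘L
      ContinuousAlternatingMap.toContinuousMultilinearMapCLM ℝ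
  obtain ⟨s, hs, hst⟩ := hf.strict
  have hint := intervalIntegrable_testForm_graph hf (extD 0 φ) 0 1
  simp only [extD_zero_apply] at hint ⊢
  -- This form of the fundamental theorem tolerates a countable exceptional set, which is why
  -- `IsProfile` asks for countability and not merely for measure zero.
  have key := integral_eq_of_hasDerivAt_off_countable (fun x => φ (graphMap f x) 0)
    (fun x => fderiv ℝ φ (graphMap f x) !₂[1, deriv f x] 0) (a := 0) (b := 1) hs
    (by
      have h1 : Continuous φ := φ.continuous
      exact (ev.continuous.comp (h1.comp (continuous_graphMap hf.continuous))).continuousOn)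
    (fun x hx => by
      have h1 := (hasStrictDerivAt_graphMap (hst x hx.2)).hasDerivAt
      have h2 : DifferentiableAt ℝ φ (graphMap f x) := φ.contDiff.differentiable (by simp) _
      have h3 := ev.hasFDerivAt.comp_hasDerivAt x (h2.hasFDerivAt.comp_hasDerivAt x h1)
      exact h3)
    hint
  rw [key]
  ring

theorem boundary_graphCurrent_congr {f g : ℝ → ℝ} (hf : IsProfile f) (hg : IsProfile g)
    (h0 : f 0 = g 0) (h1 : f 1 = g 1) : boundary (graphCurrent f) = boundary (graphCurrent g) := by
  ext1 φ
  rw [boundary_graphCurrent_apply hf, boundary_graphCurrent_apply hg]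
  simp [graphMap, h0, h1]

/-! ### Green's theorem between two graphs. -/

/-- The region over `[0,1]` between the graphs of `g` and `f`. -/
def graphRegion (g f : ℝ → ℝ) : Set Plane := {q | q 0 ∈ Icc (0 : ℝ) 1 ∧ q 1 ∈ Icc (g (q 0)) (f (q 0))}

theorem isClosed_graphRegion {g f : ℝ → ℝ} (hg : Continuous g) (hf : Continuous f) :
    IsClosed (graphRegion g f) := by
  have h0 : Continuous fun q : Plane => q 0 := by fun_prop
  have h1 : Continuous fun q : Plane => q 1 := by fun_prop
  exact (isClosed_Icc.preimage h0).inter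
    ((isClosed_le (hg.comp h0) h1).inter (isClosed_le h1 (hf.comp h0)))

theorem isBounded_graphRegion {g f : ℝ → ℝ} (hg : Continuous g) (hf : Continuous f) :
    Bornology.IsBounded (graphRegion g f) := by
  obtain ⟨a, ha⟩ := isCompact_Icc.bddBelow_image hg.continuousOn (K := Icc (0 : ℝ) 1)
  obtain ⟨b, hb⟩ := isCompact_Icc.bddAbove_image hf.continuousOn (K := Icc (0 : ℝ) 1)
  have hK : IsCompact ((fun p : ℝ × ℝ => (!₂[p.1, p.2] : Plane)) '' (Icc 0 1 ×ˢ Icc a b)) :=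
    (isCompact_Icc.prod isCompact_Icc).image (by fun_prop)
  refine hK.isBounded.subset fun q hq => ⟨(q 0, q 1), ⟨hq.1, ?_, ?_⟩, ?_⟩
  · exact (ha (mem_image_of_mem g hq.1)).trans hq.2.1
  · exact hq.2.2.trans (hb (mem_image_of_mem f hq.1))
  · ext i; fin_cases i <;> rfl

theorem measurePreserving_mk_plane :
    MeasurePreserving (fun p : ℝ × ℝ => (!₂[p.1, p.2] : Plane)) volume volume :=
  (PiLp.volume_preserving_toLp (Fin 2)).comp (volume_preserving_finTwoArrow ℝ).symm

theorem measurableEmbedding_mk_plane :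
    MeasurableEmbedding (fun p : ℝ × ℝ => (!₂[p.1, p.2] : Plane)) := by
  refine Continuous.measurableEmbedding (by fun_prop) fun p q h => ?_
  have h0 := congrArg (fun v : Plane => v 0) h
  have h1 := congrArg (fun v : Plane => v 1) h
  exact Prod.ext h0 h1

theorem setIntegral_graphRegion {g f : ℝ → ℝ} (hg : Continuous g) (hf : Continuous f)
    (hgf : ∀ x ∈ Icc (0 : ℝ) 1, g x ≤ f x) {u : Plane → ℝ} (hu : Integrable u) :
    ∫ q in graphRegion g f, u q = ∫ x in (0 : ℝ)..1, ∫ y in g x..f x, u !₂[x, y] := by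
  have hm := (isClosed_graphRegion hg hf).measurableSet
  have hi := (measurePreserving_mk_plane.integrable_comp_emb measurableEmbedding_mk_plane).2
    (hu.indicator hm)
  rw [← integral_indicator hm,
    ← measurePreserving_mk_plane.integral_comp measurableEmbedding_mk_plane,
    Measure.volume_eq_prod,
    integral_prod (fun p : ℝ × ℝ => (graphRegion g f).indicator u !₂[p.1, p.2]) hi,
    intervalIntegral.integral_of_le zero_le_one, ← integral_Icc_eq_integral_Ioc,
    ← integral_indicator measurableSet_Icc]
  congr 1 with x
  by_cases hx : x ∈ Icc (0 : ℝ) 1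
  · rw [indicator_of_mem hx, intervalIntegral.integral_of_le (hgf x hx),
      ← integral_Icc_eq_integral_Ioc, ← integral_indicator measurableSet_Icc]
    congr 1 with y
    by_cases hy : y ∈ Icc (g x) (f x)
    · rw [indicator_of_mem hy, indicator_of_mem]
      exact ⟨hx, hy⟩
    · rw [indicator_of_notMem hy, indicator_of_notMem]
      exact fun h => hy h.2
  · rw [indicator_of_notMem hx]
    refine integral_eq_zero_of_ae (Filter.Eventually.of_forall fun y => ?_)
    exact indicator_of_notMem (fun h => hx h.1) _

/-- A rescaled segment average: the segment is so long that the translated copy of `b` misses the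
ball. The factor `D` only normalizes `b` to absolute value at most 1. -/
theorem exists_vertical_primitive (b : ScalarTest) {R : ℝ} (hR : 0 ≤ R) :
    ∃ ψ : ScalarTest, ∀ x ∈ Metric.ball (0 : Plane) R, fderiv ℝ ψ x (stdFrame 1) = b x := by
  obtain ⟨C, hC⟩ := b.hasCompactSupport.exists_bound_of_continuous b.continuous
  obtain ⟨S, hS⟩ := b.hasCompactSupport.isCompact.isBounded.subset_closedBall 0
  set D := |C| + 1
  have hD : 0 < D := by positivity
  set h := R + |S| + 1
  have hh : 0 < h := by positivity
  obtain ⟨ψ, -, hψ⟩ := exists_segment_average (D⁻¹ • b) (h • stdFrame 1) fun x => by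
    change |D⁻¹ * b x| ≤ 1
    rw [abs_mul, abs_inv, abs_of_pos hD, inv_mul_le_iff₀ hD, mul_one]
    exact (hC x).trans ((le_abs_self C).trans (by simp [D]))
  refine ⟨(D * h) • ψ, fun x hx => ?_⟩
  have hd : DifferentiableAt ℝ ψ x := ψ.contDiff.differentiable (by simp) x
  have hb : b (x - h • stdFrame 1) = 0 := by
    refine image_eq_zero_of_notMem_tsupport fun hx' => ?_
    have h1 : ‖x - h • stdFrame 1‖ ≤ S := by simpa using hS hx'
    have h2 : ‖x‖ < R := by simpa using hx
    have h3 := norm_sub_norm_le (h • stdFrame 1) x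
    have h4 : ‖h • stdFrame 1‖ = h := by simp [stdFrame, norm_smul, abs_of_pos hh]
    rw [norm_sub_rev, h4] at h3
    have := le_abs_self S
    linarith
  have h5 := hψ x
  change _ = D⁻¹ * b x - D⁻¹ * b (x - h • stdFrame 1) at h5
  rw [hb, map_smul, smul_eq_mul, mul_zero, sub_zero] at h5
  change fderiv ℝ (fun y => (D * h) • ψ y) x (stdFrame 1) = b x
  rw [fderiv_fun_const_smul hd]
  change D * h * fderiv ℝ ψ x (stdFrame 1) = b x
  rw [mul_assoc, h5, mul_inv_cancel_left₀ hD.ne']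

/-- The function `φ`, as a `0`-form. -/
def zeroForm (φ : ScalarTest) : TestForm 0 :=
  constForm (ContinuousAlternatingMap.constOfIsEmpty ℝ Plane (Fin 0) 1) φ

theorem zeroForm_apply (φ : ScalarTest) (x : Plane) (v : Fin 0 → Plane) :
    zeroForm φ x v = φ x := by
  simp [zeroForm]

theorem extD_zeroForm (φ : ScalarTest) (x : Plane) (v : Fin 1 → Plane) :
    extD 0 (zeroForm φ) x v = fderiv ℝ φ x (v 0) := by
  rw [extD_zero_apply]
  have hd : DifferentiableAt ℝ (zeroForm φ) x := (zeroForm φ).contDiff.differentiable (by simp) x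
  have h1 := ((ContinuousMultilinearMap.apply ℝ (fun _ : Fin 0 => Plane) ℝ 0 ∘L
    ContinuousAlternatingMap.toContinuousMultilinearMapCLM ℝ).hasFDerivAt).comp x hd.hasFDerivAt
  have h2 : HasFDerivAt (fun y => zeroForm φ y 0) _ x := h1
  simp_rw [zeroForm_apply] at h2
  rw [h2.fderiv]
  rfl

/-- The component `β (e i)` of a one-form. -/
def component (i : Fin 2) (β : TestForm 1) : ScalarTest :=
  TestFunction.postcompCLM (ContinuousMultilinearMap.apply ℝ (fun _ : Fin 1 => Plane) ℝ
    (fun _ => stdFrame i) ∘L ContinuousAlternatingMap.toContinuousMultilinearMapCLM ℝ) β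

theorem component_apply (i : Fin 2) (β : TestForm 1) (x : Plane) :
    component i β x = β x fun _ => stdFrame i := rfl

theorem testForm_apply_mk (β : TestForm 1) (x : Plane) (a b : ℝ) :
    β x (fun _ => !₂[a, b]) = a * component 0 β x + b * component 1 β x := by
  set ℓ := (ContinuousAlternatingMap.ofSubsingletonLIE (𝕜 := ℝ) (E := Plane) (F := ℝ)
    (0 : Fin 1)).symm (β x) with hℓ
  have h (v : Plane) : β x (fun _ => v) = ℓ v := by
    have h : β x = ContinuousAlternatingMap.ofSubsingletonLIE (𝕜 := ℝ) (E := Plane) (F := ℝ)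
        (0 : Fin 1) ℓ := by
      rw [hℓ, LinearIsometryEquiv.apply_symm_apply]
    rw [h]
    rfl
  have hv : (!₂[a, b] : Plane) = a • stdFrame 0 + b • stdFrame 1 := by
    ext i; fin_cases i <;> simp [stdFrame]
  rw [component_apply, component_apply, h, h, h, hv, map_add, map_smul, map_smul]
  rfl

theorem hasDerivAt_vertical (P : ScalarTest) (x y : ℝ) :
    HasDerivAt (fun y => P !₂[x, y]) (fderiv ℝ P !₂[x, y] (stdFrame 1)) y := by
  have hd : DifferentiableAt ℝ P !₂[x, y] := P.contDiff.differentiable (by simp) _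
  refine hd.hasFDerivAt.comp_hasDerivAt y ?_
  have h1 : HasDerivAt (fun y : ℝ => (!₂[x, 0] : Plane) + y • stdFrame 1) (stdFrame 1) y := by
    simpa using ((hasDerivAt_id y).smul_const (stdFrame 1)).const_add (!₂[x, 0] : Plane)
  have e : (fun y : ℝ => (!₂[x, y] : Plane)) = fun y => (!₂[x, 0] : Plane) + y • stdFrame 1 := by
    funext z
    ext i
    fin_cases i <;> simp [stdFrame]
  rw [e]
  exact h1

/-- Green's theorem for the region between two graphs. -/
theorem boundary_topCurrent_graphRegion {g f : ℝ → ℝ} (hg : IsProfile g) (hf : IsProfile f)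
    (hgf : ∀ x ∈ Icc (0 : ℝ) 1, g x ≤ f x) (h0 : f 0 = g 0) (h1 : f 1 = g 1) :
    boundary (topCurrent (graphRegion g f)) = graphCurrent f - graphCurrent g := by
  ext1 β
  obtain ⟨R, hR0, hR⟩ := (isBounded_graphRegion hg.continuous hf.continuous).subset_ball_lt 0 0
  obtain ⟨ψ, hψ⟩ := exists_vertical_primitive (component 1 β) hR0.le
  -- Both sides of the identity ignore exact forms, the right one because the curves share end
  -- points. Removing $d\psi$ leaves $P\,dx_0$ near the region, so only vertical integration is
  -- needed and the slopes of the curves drop out.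
  set β' := β - extD 0 (zeroForm ψ) with hβ'
  have hval (x : Plane) (v : Fin 1 → Plane) : β' x v = β x v - fderiv ℝ ψ x (v 0) := by
    rw [← extD_zeroForm]
    rfl
  have hd : extD 1 β' = extD 1 β := by
    rw [hβ', map_sub, extD_extD, sub_zero]
  have hb : (graphCurrent f - graphCurrent g) β' = (graphCurrent f - graphCurrent g) β := by
    have := DFunLike.congr_fun (boundary_graphCurrent_congr hf hg h0 h1) (zeroForm ψ)
    change graphCurrent f (extD 0 _) = graphCurrent g (extD 0 _) at this
    rw [hβ', map_sub, sub_apply, sub_apply, this]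
    ring
  have hc1 (x : Plane) (hx : x ∈ Metric.ball (0 : Plane) R) : component 1 β' x = 0 := by
    rw [component_apply, hval, hψ x hx, component_apply, sub_self]
  set P := component 0 β'
  have hdv (x : Plane) (hx : x ∈ Metric.ball (0 : Plane) R) :
      extD 1 β' x stdFrame = -fderiv ℝ P x (stdFrame 1) := by
    rw [extD_one_stdFrame]
    have e : (fun y => β' y fun _ => stdFrame 1) =ᶠ[𝓝 x] fun _ => 0 :=
      Filter.eventuallyEq_of_mem (Metric.isOpen_ball.mem_nhds hx) hc1
    rw [e.fderiv_eq]
    simp only [fderiv_fun_const, Pi.zero_apply, zero_apply, zero_sub]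
    rfl
  change topCurrent (graphRegion g f) (extD 1 β) = _
  rw [← hb, ← hd, topCurrent_apply, setIntegral_congr_fun
    (isClosed_graphRegion hg.continuous hf.continuous).measurableSet fun x hx => hdv x (hR hx),
    integral_neg]
  have hdP : Continuous fun x => fderiv ℝ P x (stdFrame 1) :=
    (P.contDiff.continuous_fderiv (by simp)).clm_apply continuous_const
  have hiP : Integrable fun x => fderiv ℝ P x (stdFrame 1) :=
    hdP.integrable_of_hasCompactSupport
      ((P.hasCompactSupport.fderiv ℝ).comp_left (g := fun L : Plane →L[ℝ] ℝ => L (stdFrame 1)) rfl)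
  rw [setIntegral_graphRegion hg.continuous hf.continuous hgf hiP]
  have hinner (x : ℝ) : ∫ y in g x..f x, fderiv ℝ P !₂[x, y] (stdFrame 1) =
      P (graphMap f x) - P (graphMap g x) :=
    intervalIntegral.integral_eq_sub_of_hasDerivAt (fun y _ => hasDerivAt_vertical P x y)
      ((hdP.comp (by fun_prop)).intervalIntegrable _ _)
  have hcur {k : ℝ → ℝ} (hk : IsProfile k)
      (hkR : ∀ x ∈ Icc (0 : ℝ) 1, graphMap k x ∈ graphRegion g f) :
      graphCurrent k β' = -∫ x in (0 : ℝ)..1, P (graphMap k x) := by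
    rw [graphCurrent_eq_integral hk]
    congr 1
    refine intervalIntegral.integral_congr fun x hx => ?_
    rw [uIcc_of_le zero_le_one] at hx
    rw [testForm_apply_mk, hc1 _ (hR (hkR x hx))]
    ring
  have hPc {k : ℝ → ℝ} (hk : IsProfile k) :
      IntervalIntegrable (fun x => P (graphMap k x)) volume 0 1 :=
    (P.continuous.comp (continuous_graphMap hk.continuous)).intervalIntegrable _ _
  simp_rw [hinner]
  rw [sub_apply, hcur hf fun x hx => ⟨hx, hgf x hx, le_rfl⟩,
    hcur hg fun x hx => ⟨hx, le_rfl, hgf x hx⟩, intervalIntegral.integral_sub (hPc hf) (hPc hg)]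
  ring

/-! ### Integrality, finite perimeter and restriction for graph regions. -/

theorem hasFDerivAt_graphMap_proj {f : ℝ → ℝ} {t : EuclideanSpace ℝ (Fin 1)}
    (h : DifferentiableAt ℝ f (t 0)) (v : EuclideanSpace ℝ (Fin 1)) :
    fderiv ℝ (fun t : EuclideanSpace ℝ (Fin 1) => graphMap f (t 0)) t v =
      v 0 • !₂[1, deriv f (t 0)] := by
  have h1 : HasFDerivAt (graphMap f) (ContinuousLinearMap.toSpanSingleton ℝ
      (!₂[1, deriv f (t 0)] : Plane)) (t 0) := by
    have h2 : HasDerivAt (fun x => (![x, f x] : Fin 2 → ℝ)) ![1, deriv f (t 0)] (t 0) := by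
      refine hasDerivAt_pi.2 fun i => ?_
      fin_cases i
      · exact hasDerivAt_id _
      · exact h.hasDerivAt
    exact (((PiLp.continuousLinearEquiv 2 ℝ (fun _ : Fin 2 => ℝ)).symm
      : (Fin 2 → ℝ) →L[ℝ] Plane).hasFDerivAt.comp_hasDerivAt (t 0) h2).hasFDerivAt
  have h3 := h1.comp t (EuclideanSpace.proj (𝕜 := ℝ) (0 : Fin 1)).hasFDerivAt
  have h4 : HasFDerivAt (fun t : EuclideanSpace ℝ (Fin 1) => graphMap f (t 0)) _ t := h3
  rw [h4.fderiv]
  simp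

theorem isRectifiableCurrent_graphCurrent {f : ℝ → ℝ} (hf : IsProfile f) :
    IsRectifiableCurrent (graphCurrent f) := by
  obtain ⟨K, hK⟩ := hf.lipschitz
  refine ⟨graphSet f, fun _ => 1, fun q _ => graphOrientation f q,
    fun _ t => graphMap f (t 0), measurableSet_graphSet hf.continuous, measurable_const,
    measurable_pi_iff.2 fun _ => measurable_graphOrientation f, ?_, fun _ => ⟨1 + K, ?_⟩, ?_,
    fun q _ => orthonormal_of_norm_eq_one (norm_graphOrientation f q), fun k => ?_, fun α => ?_⟩
  · have := measure_graphSet_lt_top hf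
    simpa [IntegrableOn, integrable_const_iff, isFiniteMeasure_restrict] using this.ne
  · refine LipschitzWith.of_dist_le_mul fun s t => ?_
    refine ((LipschitzWith.graphMap hK).dist_le_mul _ _).trans ?_
    gcongr
    have := PiLp.norm_apply_le (s - t) 0
    rwa [dist_eq_norm, dist_eq_norm]
  · have : graphSet f \ ⋃ _ : ℕ, range (fun t : EuclideanSpace ℝ (Fin 1) => graphMap f (t 0)) = ∅ := by
      refine sdiff_eq_empty.2 fun q hq => mem_iUnion.2 ⟨0, !₂[q 0], ?_⟩
      exact (eq_graphMap hq.2).symm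
    rw [this, measure_empty]
  · refine Filter.Eventually.of_forall fun t _ hinj => ?_
    by_cases hd : DifferentiableAt ℝ f (t 0)
    · have hr : range (fun _ : Fin 1 => graphOrientation f (graphMap f (t 0))) =
          {graphOrientation f (graphMap f (t 0))} := range_const
      have ho : graphOrientation f (graphMap f (t 0)) =
          (-(speed f (t 0))⁻¹) • (!₂[1, deriv f (t 0)] : Plane) := by
        ext j
        fin_cases j <;> simp [graphOrientation, speed]
      have hs := (speed_pos f (t 0)).ne'
      rw [hr]
      ext w
      simp only [mem_range, SetLike.mem_coe, Submodule.mem_span_singleton,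
        hasFDerivAt_graphMap_proj hd, ho, smul_smul]
      constructor
      · rintro ⟨v, rfl⟩
        exact ⟨-(v 0 * speed f (t 0)), by congr 1; field_simp⟩
      · rintro ⟨c, rfl⟩
        exact ⟨!₂[c * -(speed f (t 0))⁻¹], rfl⟩
    -- At a point where `f` is not differentiable the parametrization has `fderiv` equal to the
    -- default value 0, which is not injective.
    · exfalso
      have hnd : ¬DifferentiableAt ℝ (fun t : EuclideanSpace ℝ (Fin 1) => graphMap f (t 0)) t := by
        intro h
        refine hd ?_
        have h1 : DifferentiableAt ℝ (fun t : EuclideanSpace ℝ (Fin 1) => graphMap f (t 0))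
            (!₂[t 0]) := by
          have ht : (!₂[t 0] : EuclideanSpace ℝ (Fin 1)) = t := by ext i; fin_cases i; rfl
          rwa [ht]
        have hm : DifferentiableAt ℝ (fun x : ℝ => (!₂[x] : EuclideanSpace ℝ (Fin 1))) (t 0) := by
          have e : (fun x : ℝ => (!₂[x] : EuclideanSpace ℝ (Fin 1))) =
              fun x => x • EuclideanSpace.single 0 1 := by
            funext x; ext i; fin_cases i; simp
          rw [e]
          fun_prop
        have h2 := (EuclideanSpace.proj (𝕜 := ℝ) (1 : Fin 2)).differentiableAt.comp (t 0)
          (DifferentiableAt.comp (t 0) h1 hm)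
        exact h2
      rw [fderiv_zero_of_not_differentiableAt hnd] at hinj
      have := @hinj (!₂[1]) 0 rfl
      have := congrArg (fun v : EuclideanSpace ℝ (Fin 1) => v 0) this
      simp at this
  · simpa using graphCurrent_apply hf α

theorem isRectifiableCurrent_boundary_graphCurrent {f : ℝ → ℝ} (hf : IsProfile f) :
    IsRectifiableCurrent (boundary (graphCurrent f)) := by
  have hne : graphMap f 0 ≠ graphMap f 1 := fun h => zero_ne_one (graphMap_injective f h)
  have hμ (q : Plane) : (μHE[0] : Measure Plane) {q} = 1 := by simp
  have hd : Disjoint ({graphMap f 0} : Set Plane) {graphMap f 1} := by simpa using hne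
  -- The left end point, recognized by its abscissa 0, is the terminal point of the leftward curve
  -- and has multiplicity $+1$.
  set m : Plane → ℤ := fun q => if q 0 = 0 then 1 else -1 with hm
  have hi (q : Plane) (u : Plane → ℝ) : IntegrableOn u {q} (μHE[0] : Measure Plane) :=
    integrableOn_singleton (hx := by rw [hμ]; exact ENNReal.one_lt_top)
  refine ⟨{graphMap f 0} ∪ {graphMap f 1}, m, fun _ => Fin.elim0,
    fun k _ => if k = 0 then graphMap f 0 else graphMap f 1,
    (measurableSet_singleton _).union (measurableSet_singleton _), ?_, ?_, ?_, ?_, ?_, ?_, ?_, ?_⟩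
  · refine Measurable.ite ?_ measurable_const measurable_const
    exact (by fun_prop : Measurable fun q : Plane => q 0) (measurableSet_singleton 0)
  · exact measurable_pi_iff.2 fun i => i.elim0
  · exact (hi _ _).union (hi _ _)
  · exact fun k => ⟨0, LipschitzWith.const _⟩
  · have : (({graphMap f 0} ∪ {graphMap f 1}) \ ⋃ k : ℕ, range (fun _ : EuclideanSpace ℝ (Fin 0) =>
        if k = 0 then graphMap f 0 else graphMap f 1) : Set Plane) = ∅ := by
      refine sdiff_eq_empty.2 ?_
      rintro q (rfl | rfl)
      · exact mem_iUnion.2 ⟨0, 0, by simp⟩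
      · exact mem_iUnion.2 ⟨1, 0, by simp⟩
    rw [this, measure_empty]
  · exact fun x _ => ⟨fun i => i.elim0, fun i => i.elim0⟩
  · refine fun k => Filter.Eventually.of_forall fun t _ _ => ?_
    ext w
    simp
  · intro φ
    rw [boundary_graphCurrent_apply hf, setIntegral_union hd (measurableSet_singleton _) (hi _ _)
      (hi _ _), integral_singleton, integral_singleton]
    have e' : (Fin.elim0 : Fin 0 → Plane) = 0 := Subsingleton.elim _ _
    simp [measureReal_def, hm, e']
    ring

theorem isIntegralCurrent_graphCurrent {f : ℝ → ℝ} (hf : IsProfile f) :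
    IsIntegralCurrent (graphCurrent f) :=
  ⟨isRectifiableCurrent_graphCurrent hf, isRectifiableCurrent_boundary_graphCurrent hf⟩

theorem mass_lt_top_of_le {p : ℕ} {T : Current p} {C : ℝ}
    (h : ∀ α : TestForm p, (∀ x, ‖α x‖ ≤ 1) → T α ≤ C) : mass T < ⊤ :=
  (iSup₂_le fun α hα => ENNReal.ofReal_le_ofReal (h α hα)).trans_lt
    (ENNReal.ofReal_lt_top (r := C))

theorem abs_graphCurrent_le {f : ℝ → ℝ} (hf : IsProfile f) {α : TestForm 1}
    (hα : ∀ x, ‖α x‖ ≤ 1) : |graphCurrent f α| ≤ μHE[1].real (graphSet f) := by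
  rw [graphCurrent_apply hf]
  simpa using norm_setIntegral_le_of_norm_le_const (C := 1)
    (f := fun q => α q fun _ => graphOrientation f q) (measure_graphSet_lt_top hf)
    fun q _ => abs_testForm_apply_le α hα q
      (orthonormal_of_norm_eq_one (norm_graphOrientation f q))

theorem mass_graphCurrent_sub_lt_top {f g : ℝ → ℝ} (hf : IsProfile f) (hg : IsProfile g) :
    mass (graphCurrent f - graphCurrent g) < ⊤ := by
  refine mass_lt_top_of_le (C := μHE[1].real (graphSet f) + μHE[1].real (graphSet g))
    fun α hα => ?_
  have h1 := (abs_le.1 (abs_graphCurrent_le hf hα)).2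
  have h2 := (abs_le.1 (abs_graphCurrent_le hg hα)).1
  rw [sub_apply]
  linarith

theorem mass_boundary_graphCurrent_lt_top {f : ℝ → ℝ} (hf : IsProfile f) :
    mass (boundary (graphCurrent f)) < ⊤ := by
  refine mass_lt_top_of_le (C := 2) fun φ hφ => ?_
  rw [boundary_graphCurrent_apply hf]
  have h (q : Plane) := abs_le.1 (abs_testForm_apply_le φ hφ q (v := 0)
    ⟨fun i => i.elim0, fun i => i.elim0⟩)
  linarith [(h (graphMap f 0)).2, (h (graphMap f 1)).1]

theorem isFinitePerimeter_graphRegion {g f : ℝ → ℝ} (hg : IsProfile g) (hf : IsProfile f)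
    (hgf : ∀ x ∈ Icc (0 : ℝ) 1, g x ≤ f x) (h0 : f 0 = g 0) (h1 : f 1 = g 1) :
    IsFinitePerimeter (graphRegion g f) := by
  refine ⟨(isClosed_graphRegion hg.continuous hf.continuous).measurableSet.nullMeasurableSet,
    (isBounded_graphRegion hg.continuous hf.continuous).measure_lt_top, ?_⟩
  rw [boundary_topCurrent_graphRegion hg hf hgf h0 h1]
  exact mass_graphCurrent_sub_lt_top hf hg

/-- Removing the null end points, which the upper and lower curves share, makes the arcs disjoint
and lets the upper one lie in an open window that avoids the lower one. -/
theorem graphCurrent_eq_setIntegral_Ioo {f : ℝ → ℝ} (hf : IsProfile f) (α : TestForm 1) :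
    graphCurrent f α =
      ∫ q in graphMap f '' Ioo 0 1, α q (fun _ => graphOrientation f q) ∂μHE[1] := by
  rw [setIntegral_graphOrientation hf measurableSet_Ioo, graphCurrent_eq_integral hf,
    intervalIntegral.integral_of_le zero_le_one, integral_Ioc_eq_integral_Ioo]

/-- The upper boundary curve is the part of the boundary of a graph region inside any window that
contains it and avoids the lower boundary curve. -/
theorem isRestriction_graphCurrent {g f : ℝ → ℝ} (hg : IsProfile g) (hf : IsProfile f)
    (hgf : ∀ x ∈ Ioo (0 : ℝ) 1, g x < f x) (h0 : f 0 = g 0) (h1 : f 1 = g 1) {U : Set Plane}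
    (hU : IsOpen U) (hfU : graphMap f '' Ioo 0 1 ⊆ U) (hgU : Disjoint (graphMap g '' Ioo 0 1) U) :
    IsRestriction (boundary (topCurrent (graphRegion g f))) U (graphCurrent f) := by
  have hgf' : ∀ x ∈ Icc (0 : ℝ) 1, g x ≤ f x := by
    intro x hx
    rcases hx.1.eq_or_lt with rfl | hx0
    · exact h0.ge
    rcases hx.2.eq_or_lt with rfl | hx1
    · exact h1.ge
    exact (hgf x ⟨hx0, hx1⟩).le
  set A := graphMap f '' Ioo 0 1
  set B := graphMap g '' Ioo 0 1
  have hA : MeasurableSet A := measurableSet_image_graphMap hf.continuous measurableSet_Ioo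
  have hB : MeasurableSet B := measurableSet_image_graphMap hg.continuous measurableSet_Ioo
  have hAB : Disjoint A B := hgU.symm.mono_left hfU
  have hsub {k : ℝ → ℝ} : graphMap k '' Ioo 0 1 ⊆ graphSet k := by
    rw [graphSet_eq_image]
    exact image_mono Ioo_subset_Icc_self
  have hfin : (μHE[1] : Measure Plane) (A ∪ B) < ⊤ :=
    (measure_union_le _ _).trans_lt (ENNReal.add_lt_top.2
      ⟨(measure_mono hsub).trans_lt (measure_graphSet_lt_top hf),
        (measure_mono hsub).trans_lt (measure_graphSet_lt_top hg)⟩)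
  classical
  -- A single unit field represents the whole boundary, with the lower arc reversed; restricting the
  -- measure to `U` then keeps exactly the upper arc.
  set ξ : Plane → Fin 1 → Plane := fun q _ =>
    if q ∈ A then graphOrientation f q else -graphOrientation g q with hξ
  have hξm : Measurable ξ := measurable_pi_iff.2 fun _ =>
    Measurable.ite hA (measurable_graphOrientation f) (measurable_graphOrientation g).neg
  have hξo (q : Plane) : Orthonormal ℝ (ξ q) := by
    refine orthonormal_of_norm_eq_one ?_
    split_ifs
    · exact norm_graphOrientation f q
    · rw [norm_neg, norm_graphOrientation]
  have hfin' : IsFiniteMeasure ((μHE[1] : Measure Plane).restrict (A ∪ B)) := ⟨by simpa using hfin⟩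
  have hi (α : TestForm 1) : IntegrableOn (fun q => α q (ξ q)) (A ∪ B) μHE[1] := by
    have := integrable_mul_testForm α (integrable_const (1 : ℝ)) hξm hξo
      (μ := (μHE[1] : Measure Plane).restrict (A ∪ B))
    simp only [one_mul] at this
    exact this
  have hAint (α : TestForm 1) : ∫ q in A, α q (ξ q) ∂μHE[1] = graphCurrent f α := by
    rw [graphCurrent_eq_setIntegral_Ioo hf]
    refine setIntegral_congr_fun hA fun q hq => ?_
    simp only [hξ, if_pos hq]
  have hBint (α : TestForm 1) : ∫ q in B, α q (ξ q) ∂μHE[1] = -graphCurrent g α := by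
    rw [graphCurrent_eq_setIntegral_Ioo hg, ← integral_neg]
    refine setIntegral_congr_fun hB fun q hq => ?_
    simp only [hξ, if_neg (disjoint_right.1 hAB hq)]
    have := (α q).map_smul_univ (fun _ : Fin 1 => (-1 : ℝ)) (fun _ => graphOrientation g q)
    simpa using this
  refine ⟨μHE[1].restrict (A ∪ B), fun _ => 1, ξ, hfin', integrable_const _, hξm, hξo,
    fun α => ?_, fun α => ?_⟩
  · simp only [one_mul]
    rw [setIntegral_union hAB hB ((hi α).mono_set subset_union_left)
      ((hi α).mono_set subset_union_right), hAint, hBint,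
      boundary_topCurrent_graphRegion hg hf hgf' h0 h1, sub_apply, sub_eq_add_neg]
  · simp only [one_mul]
    have : U ∩ (A ∪ B) = A := by
      rw [inter_union_distrib_left, inter_eq_right.2 hfU, hgU.symm.inter_eq, union_empty]
    rw [Measure.restrict_restrict hU.measurableSet, this, hAint]

/-! ### Supports, smooth points and corners. -/

theorem tsupport_constForm_subset {p : ℕ} (w : Plane [⋀^Fin p]→L[ℝ] ℝ) (φ : ScalarTest) :
    tsupport (constForm w φ) ⊆ tsupport φ := by
  refine closure_mono fun x hx h => hx ?_
  rw [constForm_apply, show φ x = 0 from h, zero_smul]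

theorem exists_scalarTest_bump {s : Set Plane} {q : Plane} (hs : s ∈ 𝓝 q) :
    ∃ χ : ScalarTest, tsupport χ ⊆ s ∧ (∀ x, 0 ≤ χ x) ∧ χ q = 1 := by
  obtain ⟨χ, hχs, hχc, hχ, hr, h1⟩ := exists_contDiff_tsupport_subset (n := (⊤ : ℕ∞)) hs
  exact ⟨⟨χ, hχ, hχc, by simp⟩, hχs, fun x => (hr (mem_range_self x)).1, h1⟩

theorem isClosed_graphSet {f : ℝ → ℝ} (hf : Continuous f) : IsClosed (graphSet f) := by
  rw [graphSet_eq_image]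
  exact (isCompact_Icc.image (continuous_graphMap hf)).isClosed

theorem dsupport_graphCurrent {f : ℝ → ℝ} (hf : IsProfile f) :
    Distribution.dsupport (graphCurrent f) = graphSet f := by
  ext q
  constructor
  · intro hq
    refine (Distribution.mem_dsupport_iff q).1 hq _ (fun α hα => ?_)
      (isClosed_graphSet hf.continuous)
    rw [graphCurrent_apply hf, setIntegral_congr_fun (measurableSet_graphSet hf.continuous)
      (g := fun _ => (0 : ℝ)) fun q hq => ?_]
    · simp
    · have : α q = 0 := image_eq_zero_of_notMem_tsupport fun h => hα h hq
      simp [this]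
  · intro hq
    refine (Distribution.mem_dsupport_iff_forall_exists_ne q).2 fun s hqs hs => ?_
    obtain ⟨χ, hχs, hχ0, hχq⟩ := exists_scalarTest_bump (hs.mem_nhds hqs)
    -- On the tangent $(1,f')$ the covector $dx_0$ equals 1, so the current returns minus the
    -- integral of a nonnegative bump along the graph and nothing cancels.
    refine ⟨constForm (coordForm 0) χ, (tsupport_constForm_subset _ χ).trans hχs, ?_⟩
    rw [graphCurrent_eq_integral hf]
    have hpos : 0 < ∫ x in (0 : ℝ)..1, χ (graphMap f x) := by
      refine intervalIntegral.integral_pos one_pos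
        (χ.continuous.comp (continuous_graphMap hf.continuous)).continuousOn
        (fun x _ => hχ0 _) ⟨q 0, hq.1, ?_⟩
      rw [← eq_graphMap hq.2, hχq]
      exact one_pos
    simp [hpos.ne']

theorem graphMap_zero_ne_one (f : ℝ → ℝ) : graphMap f 0 ≠ graphMap f 1 :=
  fun h => zero_ne_one (graphMap_injective f h)

theorem dsupport_boundary_graphCurrent {f : ℝ → ℝ} (hf : IsProfile f) :
    Distribution.dsupport (boundary (graphCurrent f)) = {graphMap f 0, graphMap f 1} := by
  have hne := graphMap_zero_ne_one f
  ext q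
  constructor
  · intro hq
    refine (Distribution.mem_dsupport_iff q).1 hq _ (fun φ hφ => ?_) (toFinite _).isClosed
    have h (x : Plane) (hx : x ∈ ({graphMap f 0, graphMap f 1} : Set Plane)) : φ x = 0 :=
      image_eq_zero_of_notMem_tsupport fun h => hφ h hx
    rw [boundary_graphCurrent_apply hf, h _ (by simp), h _ (by simp), sub_self]
  · intro hq
    refine (Distribution.mem_dsupport_iff_forall_exists_ne q).2 fun s hqs hs => ?_
    have key (a b : Plane) (hab : a ≠ b) (ha : a ∈ s) :
        ∃ χ : ScalarTest, tsupport χ ⊆ s ∧ χ a = 1 ∧ χ b = 0 := by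
      obtain ⟨χ, hχs, -, hχa⟩ := exists_scalarTest_bump
        ((hs.inter isOpen_compl_singleton).mem_nhds ⟨ha, mem_compl_singleton_iff.2 hab⟩)
      exact ⟨χ, fun x hx => (hχs hx).1, hχa,
        image_eq_zero_of_notMem_tsupport fun h => (hχs h).2 rfl⟩
    rcases hq with rfl | rfl
    · obtain ⟨χ, hχs, h1, h0⟩ := key _ _ hne hqs
      refine ⟨zeroForm χ, (tsupport_constForm_subset _ χ).trans hχs, ?_⟩
      rw [boundary_graphCurrent_apply hf, zeroForm_apply, zeroForm_apply, h1, h0]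
      norm_num
    · obtain ⟨χ, hχs, h1, h0⟩ := key _ _ hne.symm hqs
      refine ⟨zeroForm χ, (tsupport_constForm_subset _ χ).trans hχs, ?_⟩
      rw [boundary_graphCurrent_apply hf, zeroForm_apply, zeroForm_apply, h1, h0]
      norm_num

theorem interiorPoints_graphCurrent {f : ℝ → ℝ} (hf : IsProfile f) :
    interiorPoints (graphCurrent f) = graphMap f '' Ioo 0 1 := by
  rw [interiorPoints, dsupport_graphCurrent hf, dsupport_boundary_graphCurrent hf,
    graphSet_eq_image, ← image_pair, ← image_sdiff (graphMap_injective f), Icc_sdiff_both]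

theorem isSmoothAt_graphCurrent {f : ℝ → ℝ} (hf : IsProfile f) (hs : ContDiff ℝ ∞ f) {q : Plane}
    (hq : q ∈ interiorPoints (graphCurrent f)) : IsSmoothAt ⊤ (graphCurrent f) q := by
  rw [interiorPoints_graphCurrent hf] at hq
  obtain ⟨x, hx, rfl⟩ := hq
  have hc : Continuous fun q : Plane => q 0 := by fun_prop
  refine ⟨{q | q 0 ∈ Ioo (0 : ℝ) 1}, fun q => q 1 - f (q 0), isOpen_Ioo.preimage hc, hx, ?_, ?_, ?_⟩
  · have h0 : ContDiff ℝ ∞ fun q : Plane => q 0 := by fun_prop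
    have h1 : ContDiff ℝ ∞ fun q : Plane => q 1 := by fun_prop
    exact (h1.sub (hs.comp h0)).contDiffOn
  · have hd : DifferentiableAt ℝ f x := hs.differentiable (by simp) x
    have h1 := (EuclideanSpace.proj (𝕜 := ℝ) (1 : Fin 2)).hasFDerivAt (x := graphMap f x)
    have h2 := HasDerivAt.comp_hasFDerivAt (graphMap f x) (h₂ := f) (f := fun q : Plane => q 0)
      hd.hasDerivAt (EuclideanSpace.proj (𝕜 := ℝ) (0 : Fin 2)).hasFDerivAt
    have h3 : HasFDerivAt (fun q : Plane => q 1 - f (q 0)) _ (graphMap f x) := h1.sub h2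
    rw [h3.fderiv]
    intro h
    have := DFunLike.congr_fun h (stdFrame 1)
    simp [stdFrame] at this
  · rw [dsupport_graphCurrent hf]
    ext q
    constructor
    · rintro ⟨h1, h2⟩
      exact ⟨h2, sub_eq_zero.2 h1.2⟩
    · rintro ⟨h1, h2⟩
      exact ⟨⟨Ioo_subset_Icc_self h1, sub_eq_zero.1 h2⟩, h1⟩

/-- A graph with a corner is not a `C¹` curve. -/
theorem not_isSmoothAt_of_corner {f : ℝ → ℝ} (hf : IsProfile f) {x a b : ℝ}
    (hx : x ∈ Ioo (0 : ℝ) 1) (ha : HasDerivWithinAt f a (Iic x) x)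
    (hb : HasDerivWithinAt f b (Ici x) x) (hab : a ≠ b) :
    ¬IsSmoothAt 1 (graphCurrent f) (graphMap f x) := by
  rintro ⟨V, φ, hV, hxV, hφ, hne, heq⟩
  rw [dsupport_graphCurrent hf] at heq
  have hd : HasFDerivAt φ (fderiv ℝ φ (graphMap f x)) (graphMap f x) :=
    ((hφ.contDiffAt (hV.mem_nhds hxV)).differentiableAt (by simp)).hasFDerivAt
  have hz : (fun t => φ (graphMap f t)) =ᶠ[𝓝 x] fun _ => 0 := by
    filter_upwards [isOpen_Ioo.mem_nhds hx,
      (continuous_graphMap hf.continuous).continuousAt.preimage_mem_nhds (hV.mem_nhds hxV)]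
      with t ht htV
    have : graphMap f t ∈ graphSet f ∩ V := ⟨⟨Ioo_subset_Icc_self ht, rfl⟩, htV⟩
    rw [heq] at this
    exact this.2
  -- Differentiating $\varphi=0$ along the curve from one side puts the velocity $(1,c)$ in the
  -- kernel of $D\varphi$. Two different slopes span the plane and force $D\varphi=0$.
  have key {c : ℝ} {s : Set ℝ} (hc : HasDerivWithinAt f c s x) (hs : UniqueDiffWithinAt ℝ s x) :
      fderiv ℝ φ (graphMap f x) !₂[1, c] = 0 := by
    have h2 : HasDerivWithinAt (fun x => (![x, f x] : Fin 2 → ℝ)) ![1, c] s x := by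
      refine hasDerivWithinAt_pi.2 fun i => ?_
      fin_cases i
      · exact hasDerivWithinAt_id _ _
      · exact hc
    have h3 : HasDerivWithinAt (graphMap f) !₂[1, c] s x :=
      ((PiLp.continuousLinearEquiv 2 ℝ (fun _ : Fin 2 => ℝ)).symm
        : (Fin 2 → ℝ) →L[ℝ] Plane).hasFDerivAt.comp_hasDerivWithinAt x h2
    have h4 := hd.comp_hasDerivWithinAt x h3
    have h5 : HasDerivWithinAt (fun t => φ (graphMap f t)) 0 s x :=
      ((hasDerivAt_const x (0 : ℝ)).congr_of_eventuallyEq hz).hasDerivWithinAt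
    exact hs.eq_deriv s h4 h5
  have k1 := key ha (uniqueDiffOn_Iic x x self_mem_Iic)
  have k2 := key hb (uniqueDiffOn_Ici x x self_mem_Ici)
  set L := fderiv ℝ φ (graphMap f x)
  have e (c : ℝ) : (!₂[1, c] : Plane) = stdFrame 0 + c • stdFrame 1 := by
    ext i; fin_cases i <;> simp [stdFrame]
  rw [e, map_add, map_smul, smul_eq_mul] at k1 k2
  have h1 : L (stdFrame 1) = 0 := by
    have : (a - b) * L (stdFrame 1) = 0 := by linarith
    exact (mul_eq_zero.1 this).resolve_left (sub_ne_zero.2 hab)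
  have h0 : L (stdFrame 0) = 0 := by rw [h1] at k1; linarith
  refine hne (ContinuousLinearMap.ext fun v => ?_)
  have hv : v = v 0 • stdFrame 0 + v 1 • stdFrame 1 := by
    ext i; fin_cases i <;> simp [stdFrame]
  rw [hv, map_add, map_smul, map_smul, h0, h1]
  simp

/-! ### Majority sets. -/

/-- The measure of the symmetric difference. -/
def symmDist (A B : Set Plane) : ℝ≥0∞ := volume (A \ B) + volume (B \ A)

theorem symmDist_eq_lintegral {A B : Set Plane} (hA : NullMeasurableSet A volume)
    (hB : NullMeasurableSet B volume) :
    symmDist A B = ∫⁻ x, (A \ B ∪ B \ A).indicator 1 x := by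
  rw [lintegral_indicator_one₀ ((hA.diff hB).union (hB.diff hA)),
    measure_union₀ (hB.diff hA) disjoint_sdiff_sdiff.aedisjoint, symmDist]

/-- The majority set is the unique minimizer of the total symmetric difference to three sets. -/
theorem sum_symmDist_majority_add_le {A : Fin 3 → Set Plane} {F M : Set Plane}
    (hA : ∀ i, NullMeasurableSet (A i) volume) (hF : NullMeasurableSet F volume)
    (hMm : NullMeasurableSet M volume)
    (hM : M = A 0 ∩ A 1 ∪ A 1 ∩ A 2 ∪ A 0 ∩ A 2) :
    (∑ i, symmDist M (A i)) + symmDist F M ≤ ∑ i, symmDist F (A i) := by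
  have hm {B C : Set Plane} (hB : NullMeasurableSet B volume) (hC : NullMeasurableSet C volume) :
      AEMeasurable ((B \ C ∪ C \ B).indicator (1 : Plane → ℝ≥0∞)) :=
    aemeasurable_one.indicator₀ ((hB.diff hC).union (hC.diff hB))
  simp only [Fin.sum_univ_three]
  rw [symmDist_eq_lintegral hMm (hA 0), symmDist_eq_lintegral hMm (hA 1),
    symmDist_eq_lintegral hMm (hA 2), symmDist_eq_lintegral hF hMm,
    symmDist_eq_lintegral hF (hA 0), symmDist_eq_lintegral hF (hA 1),
    symmDist_eq_lintegral hF (hA 2),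
    ← lintegral_add_right' _ (hm hMm (hA 1)), ← lintegral_add_right' _ (hm hMm (hA 2)),
    ← lintegral_add_right' _ (hm hF hMm), ← lintegral_add_right' _ (hm hF (hA 1)),
    ← lintegral_add_right' _ (hm hF (hA 2))]
  -- Pointwise, majority disagrees with at most one of the three sets, and the opposite choice with
  -- at least two; so leaving the majority costs at least 1 at each such point.
  refine lintegral_mono fun x => ?_
  rw [hM]
  by_cases h : x ∈ F <;> by_cases h0 : x ∈ A 0 <;> by_cases h1 : x ∈ A 1 <;>
    by_cases h2 : x ∈ A 2 <;> simp [indicator, h, h0, h1, h2]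

/-! ### The window and the competing curves. -/

/-- The lower boundary curve. -/
def lowerCurve (x : ℝ) : ℝ := |2 * x - 1|

theorem isProfile_of_contDiff {f : ℝ → ℝ} (hf : ContDiff ℝ ∞ f) {K : ℝ≥0}
    (hK : LipschitzWith K f) : IsProfile f :=
  ⟨⟨K, hK⟩, ∅, countable_empty, fun x _ => by
    have h := hf.contDiffAt.hasStrictDerivAt (x := x) (by simp)
    exact h⟩

theorem isProfile_lowerCurve : IsProfile lowerCurve := by
  refine ⟨⟨2, LipschitzWith.of_dist_le_mul fun x y => ?_⟩, {1 / 2}, countable_singleton _,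
    fun x hx => ?_⟩
  · rw [Real.dist_eq, Real.dist_eq]
    refine (abs_abs_sub_abs_le_abs_sub _ _).trans_eq ?_
    rw [show 2 * x - 1 - (2 * y - 1) = 2 * (x - y) by ring, abs_mul]
    simp
  · have h0 : 2 * x - 1 ≠ 0 := fun h => hx (by rw [mem_singleton_iff]; linarith)
    have h : ContDiffAt ℝ 1 lowerCurve x := by
      have h1 : ContDiffAt ℝ 1 (fun x : ℝ => 2 * x - 1) x := by fun_prop
      exact h1.abs h0
    exact h.hasStrictDerivAt (by simp)

/-- The curves that differ from the segment at height `1` only over `[1/4, 3/4]`, by at most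
`1/4`. -/
structure IsCompetitor (f : ℝ → ℝ) : Prop extends IsProfile f where
  eq_one : ∀ x ∉ Icc (1 / 4 : ℝ) (3 / 4), f x = 1
  le : ∀ x, 3 / 4 ≤ f x
  ge : ∀ x, f x ≤ 5 / 4

namespace IsCompetitor

variable {f : ℝ → ℝ}

theorem at_zero (hf : IsCompetitor f) : f 0 = 1 := hf.eq_one 0 (by norm_num)

theorem at_one (hf : IsCompetitor f) : f 1 = 1 := hf.eq_one 1 (by norm_num)

/-- Over $[1/4,3/4]$ the lower curve is at most $1/2$, below the minimal height $3/4$; elsewhere in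
$(0,1)$ it stays below 1, which it reaches only at the end points. -/
theorem lowerCurve_lt (hf : IsCompetitor f) {x : ℝ} (hx : x ∈ Ioo (0 : ℝ) 1) :
    lowerCurve x < f x := by
  rw [lowerCurve]
  by_cases h : x ∈ Icc (1 / 4 : ℝ) (3 / 4)
  · refine lt_of_le_of_lt (abs_le.2 ⟨?_, ?_⟩ : |2 * x - 1| ≤ 1 / 2) ?_
    · linarith [h.1]
    · linarith [h.2]
    · linarith [hf.le x]
  · rw [hf.eq_one x h, abs_lt]
    constructor <;> linarith [hx.1, hx.2]

theorem lowerCurve_zero : lowerCurve 0 = 1 := by norm_num [lowerCurve]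

theorem lowerCurve_one : lowerCurve 1 = 1 := by norm_num [lowerCurve]

theorem lowerCurve_le (hf : IsCompetitor f) {x : ℝ} (hx : x ∈ Icc (0 : ℝ) 1) :
    lowerCurve x ≤ f x := by
  rcases hx.1.eq_or_lt with rfl | hx0
  · rw [hf.at_zero, lowerCurve_zero]
  rcases hx.2.eq_or_lt with rfl | hx1
  · rw [hf.at_one, lowerCurve_one]
  exact (hf.lowerCurve_lt ⟨hx0, hx1⟩).le

end IsCompetitor

/-- The window in which the competing curves live. -/
def window : Set Plane := {q | q 0 ∈ Ioo (0 : ℝ) 1 ∧ q 1 ∈ Ioo (lowerCurve (q 0)) 3}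

/-- The part of the window in which competing curves may differ. -/
def innerWindow : Set Plane :=
  {q | q 0 ∈ Ioo (3 / 16 : ℝ) (13 / 16) ∧ q 1 ∈ Ioo (11 / 16 : ℝ) 2}

theorem continuous_coord (i : Fin 2) : Continuous fun q : Plane => q i := by fun_prop

theorem isOpen_window : IsOpen window :=
  (isOpen_Ioo.preimage (continuous_coord 0)).inter
    ((isOpen_lt (isProfile_lowerCurve.continuous.comp (continuous_coord 0))
      (continuous_coord 1)).inter (isOpen_lt (continuous_coord 1) continuous_const))

theorem isOpen_innerWindow : IsOpen innerWindow :=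
  (isOpen_Ioo.preimage (continuous_coord 0)).inter (isOpen_Ioo.preimage (continuous_coord 1))

theorem window_subset_ball : window ⊆ Metric.ball (0 : Plane) 4 := by
  rintro q ⟨h0, h1⟩
  have : 0 ≤ lowerCurve (q 0) := abs_nonneg _
  have h2 : 0 < q 1 := this.trans_lt h1.1
  rw [mem_ball_zero_iff, EuclideanSpace.norm_eq, Real.sqrt_lt' (by norm_num), Fin.sum_univ_two,
    Real.norm_eq_abs, Real.norm_eq_abs, sq_abs, sq_abs]
  nlinarith [h0.1, h0.2, h1.2]

/-- Abscissae within $5/16$ of $1/2$ give $|2x-1|\le5/8<11/16$. -/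
theorem closure_innerWindow_subset : closure innerWindow ⊆ window := by
  have h : closure innerWindow ⊆
      {q | q 0 ∈ Icc (3 / 16 : ℝ) (13 / 16) ∧ q 1 ∈ Icc (11 / 16 : ℝ) 2} :=
    closure_minimal (fun q hq => ⟨Ioo_subset_Icc_self hq.1, Ioo_subset_Icc_self hq.2⟩)
      ((isClosed_Icc.preimage (continuous_coord 0)).inter
        (isClosed_Icc.preimage (continuous_coord 1)))
  intro q hq
  obtain ⟨h0, h1⟩ := h hq
  refine ⟨⟨by linarith [h0.1], by linarith [h0.2]⟩, ?_, by linarith [h1.2]⟩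
  refine lt_of_lt_of_le ?_ h1.1
  rw [lowerCurve, abs_lt]
  constructor <;> linarith [h0.1, h0.2]

theorem isCompact_closure_innerWindow : IsCompact (closure innerWindow) :=
  (Metric.isBounded_ball.subset
    (subset_closure.trans (closure_innerWindow_subset.trans window_subset_ball))).isCompact_closure

/-- The region below a competing curve. -/
abbrev region (f : ℝ → ℝ) : Set Plane := graphRegion lowerCurve f

/-- The reference region. -/
abbrev baseRegion : Set Plane := region fun _ => 1

namespace IsCompetitor

variable {f : ℝ → ℝ}

theorem isFinitePerimeter (hf : IsCompetitor f) : IsFinitePerimeter (region f) :=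
  isFinitePerimeter_graphRegion isProfile_lowerCurve hf.toIsProfile (fun _ hx => hf.lowerCurve_le hx)
    (by rw [hf.at_zero, lowerCurve_zero]) (by rw [hf.at_one, lowerCurve_one])

theorem isRestriction (hf : IsCompetitor f) :
    IsRestriction (boundary (topCurrent (region f))) window (graphCurrent f) := by
  refine isRestriction_graphCurrent isProfile_lowerCurve hf.toIsProfile
    (fun _ hx => hf.lowerCurve_lt hx)
    (by rw [hf.at_zero, lowerCurve_zero]) (by rw [hf.at_one, lowerCurve_one]) isOpen_window ?_ ?_
  · rintro _ ⟨x, hx, rfl⟩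
    exact ⟨hx, hf.lowerCurve_lt hx, lt_of_le_of_lt (hf.ge x) (by norm_num)⟩
  · refine disjoint_left.2 ?_
    rintro _ ⟨x, hx, rfl⟩ h
    exact lt_irrefl _ h.2.1

/-- Over $[1/4,3/4]$ the heights $1$ and $f$ lie in $[3/4,5/4]\subset(11/16,2)$, so a point outside
the inner window is below both or above both. -/
theorem base_diff_eq (hf : IsCompetitor f) :
    baseRegion \ innerWindow = region f \ innerWindow := by
  ext q
  simp only [mem_sdiff, and_congr_left_iff]
  intro hq
  change (q 0 ∈ _ ∧ _ ≤ q 1 ∧ q 1 ≤ 1) ↔ (q 0 ∈ _ ∧ _ ≤ q 1 ∧ q 1 ≤ f (q 0))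
  by_cases h : q 0 ∈ Icc (1 / 4 : ℝ) (3 / 4)
  · have h1 : q 1 ∉ Ioo (11 / 16 : ℝ) 2 := fun h1 =>
      hq ⟨⟨by linarith [h.1], by linarith [h.2]⟩, h1⟩
    have h2 : q 1 ≤ 11 / 16 ∨ 2 ≤ q 1 := by
      by_contra! h2
      exact h1 h2
    have h3 := hf.le (q 0)
    have h4 := hf.ge (q 0)
    rcases h2 with h2 | h2
    · have e1 : q 1 ≤ 1 := by linarith
      have e2 : q 1 ≤ f (q 0) := by linarith
      simp [e1, e2]
    · have e1 : ¬q 1 ≤ 1 := by linarith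
      have e2 : ¬q 1 ≤ f (q 0) := by linarith
      simp [e1, e2]
  · rw [hf.eq_one _ h]

theorem graphCurrent_mem (hf : IsCompetitor f) :
    graphCurrent f ∈ boundaryPieces baseRegion window :=
  ⟨isIntegralCurrent_graphCurrent hf.toIsProfile, region f, hf.isFinitePerimeter, hf.isRestriction,
    innerWindow, isOpen_innerWindow, isCompact_closure_innerWindow, closure_innerWindow_subset,
    hf.base_diff_eq⟩

theorem nullMeasurableSet (hf : IsCompetitor f) : NullMeasurableSet (region f) volume :=
  hf.isFinitePerimeter.1

end IsCompetitor

theorem isCompetitor_one : IsCompetitor fun _ => 1 where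
  toIsProfile := isProfile_of_contDiff contDiff_const (LipschitzWith.const 1)
  eq_one _ _ := rfl
  le _ := by norm_num
  ge _ := by norm_num

theorem isAdmissible_base : IsAdmissible baseRegion window :=
  ⟨isCompetitor_one.isFinitePerimeter, isOpen_window,
    Metric.isBounded_ball.subset window_subset_ball, _, isCompetitor_one.isRestriction,
    mass_boundary_graphCurrent_lt_top isCompetitor_one.toIsProfile⟩

/-! ### Flat distance as symmetric difference, and the unique median. -/

theorem sub_graphCurrent_eq_boundary {S : Current 1} {F U' : Set Plane}
    (hF : NullMeasurableSet F volume) (hr : IsRestriction (boundary (topCurrent F)) window S)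
    (hU' : closure U' ⊆ window) (hEF : baseRegion \ U' = F \ U') {f : ℝ → ℝ}
    (hf : IsCompetitor f) :
    S - graphCurrent f = boundary (topCurrent F - topCurrent (region f)) ∧
      F \ region f ⊆ Metric.ball 0 4 ∧ region f \ F ⊆ Metric.ball 0 4 := by
  refine ⟨sub_eq_boundary_of_isRestriction hF hf.nullMeasurableSet isOpen_window hr
      hf.isRestriction hU' closure_innerWindow_subset hEF hf.base_diff_eq, ?_, ?_⟩
  all_goals
    intro x hx
    by_contra hn
    have h1 : x ∉ U' := fun h => hn (window_subset_ball (hU' (subset_closure h)))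
    have h2 : x ∉ innerWindow := fun h =>
      hn (window_subset_ball (closure_innerWindow_subset (subset_closure h)))
  · exact hx.2 (hf.base_diff_eq.subset ⟨(hEF.superset ⟨hx.1, h1⟩).1, h2⟩).1
  · exact hx.2 (hEF.subset ⟨(hf.base_diff_eq.superset ⟨hx.1, h2⟩).1, h1⟩).1

/-- The point is the order of quantifiers: one set $F$ serves for the comparison of $S$ with every
competing curve at once. -/
theorem exists_region_of_mem_boundaryPieces {S : Current 1}
    (hS : S ∈ boundaryPieces baseRegion window) :
    ∃ F : Set Plane, NullMeasurableSet F volume ∧ ∀ f, IsCompetitor f →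
      S - graphCurrent f = boundary (topCurrent F - topCurrent (region f)) ∧
      F \ region f ⊆ Metric.ball 0 4 ∧ region f \ F ⊆ Metric.ball 0 4 := by
  obtain ⟨-, F, hF, hr, U', -, -, hU', hEF⟩ := hS
  exact ⟨F, hF.1, fun f hf => sub_graphCurrent_eq_boundary hF.1 hr hU' hEF hf⟩

theorem topCurrent_sub_eq_zero {F G : Set Plane} (hF : NullMeasurableSet F volume)
    (hG : NullMeasurableSet G volume) (h : symmDist F G = 0) :
    topCurrent F - topCurrent G = 0 := by
  obtain ⟨h1, h2⟩ := add_eq_zero.1 h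
  ext1 α
  rw [topCurrent_sub_apply hF hG, setIntegral_measure_zero _ h1, setIntegral_measure_zero _ h2]
  simp

theorem symmDist_ne_top {F G : Set Plane} {R : ℝ} (h1 : F \ G ⊆ Metric.ball 0 R)
    (h2 : G \ F ⊆ Metric.ball 0 R) : symmDist F G ≠ ⊤ :=
  ENNReal.add_ne_top.2 ⟨measure_ne_top_of_subset h1 measure_ball_lt_top.ne,
    measure_ne_top_of_subset h2 measure_ball_lt_top.ne⟩

theorem flatNorm_boundary_le_symmDist {F G : Set Plane} (hF : NullMeasurableSet F volume)
    (hG : NullMeasurableSet G volume) {R : ℝ} (h1 : F \ G ⊆ Metric.ball 0 R)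
    (h2 : G \ F ⊆ Metric.ball 0 R) (lam : ℝ≥0) :
    flatNorm lam (boundary (topCurrent F - topCurrent G)) ≤ lam * symmDist F G := by
  refine (flatNorm_boundary_le _ _).trans ?_
  gcongr
  exact mass_topCurrent_sub_le hF hG (measure_ne_top_of_subset h1 measure_ball_lt_top.ne)
    (measure_ne_top_of_subset h2 measure_ball_lt_top.ne)

/-- The constant is $9=2R+1$ for the ball of radius $R=4$ containing the window; it is the bound on
the comass of the calibration. -/
theorem flatNormFills_of_le {N : ℕ} {f : Fin N → ℝ → ℝ} (hf : ∀ i, IsCompetitor (f i)) {lam : ℝ≥0}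
    (hlam : (lam : ℝ) * 9 ≤ 1) :
    FlatNormFills lam baseRegion window fun i => graphCurrent (f i) := by
  intro S hS i
  obtain ⟨F, hF, h⟩ := exists_region_of_mem_boundaryPieces hS
  obtain ⟨he, h1, h2⟩ := h (f i) (hf i)
  refine ⟨topCurrent F - topCurrent (region (f i)), he.symm, ?_⟩
  simp only [he, sub_self, mass_zero, zero_add]
  refine le_antisymm (flatNorm_boundary_le _ _) ?_
  refine le_trans ?_ (measure_le_flatNorm hF (hf i).nullMeasurableSet (R := 4) (by norm_num) h1 h2
    (by norm_num; exact hlam))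
  gcongr
  exact mass_topCurrent_sub_le hF (hf i).nullMeasurableSet
    (measure_ne_top_of_subset h1 measure_ball_lt_top.ne)
    (measure_ne_top_of_subset h2 measure_ball_lt_top.ne)

/-- No smallness of $\lambda$ is needed here: the assumed optimal filling $Q$ has the boundary of
$[[F]]-[[F_i]]$, and the calibration bounds the mass of any such $Q$ from below. -/
theorem flatNorm_eq_of_flatNormFills {N : ℕ} {f : Fin N → ℝ → ℝ} (hf : ∀ i, IsCompetitor (f i))
    {lam : ℝ≥0} (hfill : FlatNormFills lam baseRegion window fun i => graphCurrent (f i))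
    {S : Current 1} (hS : S ∈ boundaryPieces baseRegion window) {F : Set Plane}
    (hF : NullMeasurableSet F volume) (i : Fin N)
    (he : S - graphCurrent (f i) = boundary (topCurrent F - topCurrent (region (f i))))
    (h1 : F \ region (f i) ⊆ Metric.ball 0 4) (h2 : region (f i) \ F ⊆ Metric.ball 0 4) :
    flatNorm lam (S - graphCurrent (f i)) = lam * symmDist F (region (f i)) := by
  refine le_antisymm ?_ ?_
  · rw [he]
    exact flatNorm_boundary_le_symmDist hF (hf i).nullMeasurableSet h1 h2 lam
  · obtain ⟨Q, hQ, hQm⟩ := hfill S hS i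
    simp only at hQ hQm
    rw [hQm]
    refine le_trans ?_ le_add_self
    gcongr
    exact measure_le_mass_of_boundary_eq hF (hf i).nullMeasurableSet (by norm_num) h1 h2
      (hQ.trans he)

/-- The median of three numbers whose third dominates is the maximum of the first two. -/
theorem graphRegion_majority {g : ℝ → ℝ} {f : Fin 3 → ℝ → ℝ} {m : ℝ → ℝ}
    (hm : m = fun x => max (f 0 x) (f 1 x)) (h02 : ∀ x, f 0 x ≤ f 2 x) (h12 : ∀ x, f 1 x ≤ f 2 x) :
    graphRegion g m = graphRegion g (f 0) ∩ graphRegion g (f 1) ∪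
      graphRegion g (f 1) ∩ graphRegion g (f 2) ∪ graphRegion g (f 0) ∩ graphRegion g (f 2) := by
  subst hm
  ext q
  have h0 := h02 (q 0)
  have h1 := h12 (q 0)
  simp only [graphRegion, mem_union, mem_inter_iff, mem_ofPred_eq, mem_Icc, le_max_iff]
  constructor
  · rintro ⟨hx, hg, h | h⟩
    · exact Or.inr ⟨⟨hx, hg, h⟩, hx, hg, h.trans h0⟩
    · exact Or.inl (Or.inr ⟨⟨hx, hg, h⟩, hx, hg, h.trans h1⟩)
  · rintro ((⟨h, -⟩ | ⟨h, -⟩) | ⟨h, -⟩)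
    · exact ⟨h.1, h.2.1, Or.inl h.2.2⟩
    · exact ⟨h.1, h.2.1, Or.inr h.2.2⟩
    · exact ⟨h.1, h.2.1, Or.inl h.2.2⟩

/-- The unique median of three curves, the third of which dominates the other two, is the upper
envelope of the first two. -/
theorem isMedian_iff_eq_graphCurrent {f : Fin 3 → ℝ → ℝ} {m : ℝ → ℝ}
    (hf : ∀ i, IsCompetitor (f i)) (hmc : IsCompetitor m)
    (hm : m = fun x => max (f 0 x) (f 1 x)) (h02 : ∀ x, f 0 x ≤ f 2 x) (h12 : ∀ x, f 1 x ≤ f 2 x)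
    {lam : ℝ≥0} (hlam : 0 < lam)
    (hfill : FlatNormFills lam baseRegion window fun i => graphCurrent (f i)) (S : Current 1) :
    IsMedian lam baseRegion window (fun i => graphCurrent (f i)) S ↔ S = graphCurrent m := by
  have hsum {S : Current 1} (hS : S ∈ boundaryPieces baseRegion window) {F : Set Plane}
      (hF : NullMeasurableSet F volume) (h : ∀ f, IsCompetitor f →
        S - graphCurrent f = boundary (topCurrent F - topCurrent (region f)) ∧
        F \ region f ⊆ Metric.ball 0 4 ∧ region f \ F ⊆ Metric.ball 0 4) :
      ∑ i, flatNorm lam (S - graphCurrent (f i)) = lam * ∑ i, symmDist F (region (f i)) := by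
    rw [Finset.mul_sum]
    refine Finset.sum_congr rfl fun i _ => ?_
    obtain ⟨he, h1, h2⟩ := h (f i) (hf i)
    exact flatNorm_eq_of_flatNormFills hf hfill hS hF i he h1 h2
  have hsub : ∀ g, IsCompetitor g →
      graphCurrent m - graphCurrent g = boundary (topCurrent (region m) - topCurrent (region g)) ∧
      region m \ region g ⊆ Metric.ball 0 4 ∧ region g \ region m ⊆ Metric.ball 0 4 := fun g hg =>
    sub_graphCurrent_eq_boundary hmc.nullMeasurableSet hmc.isRestriction
      closure_innerWindow_subset hmc.base_diff_eq hg
  have hmaj {F : Set Plane} (hF : NullMeasurableSet F volume) :=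
    sum_symmDist_majority_add_le (A := fun i => region (f i)) (fun i => (hf i).nullMeasurableSet)
      hF hmc.nullMeasurableSet (graphRegion_majority hm h02 h12)
  have hl0 : (lam : ℝ≥0∞) ≠ 0 := by simpa using hlam.ne'
  constructor
  · rintro ⟨hS, hmin⟩
    obtain ⟨F, hF, h⟩ := exists_region_of_mem_boundaryPieces hS
    have h1 := hmin _ hmc.graphCurrent_mem
    rw [hsum hS hF h, hsum hmc.graphCurrent_mem hmc.nullMeasurableSet hsub,
      ENNReal.mul_le_mul_iff_right hl0 ENNReal.coe_ne_top] at h1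
    have hfin : ∑ i, symmDist (region m) (region (f i)) ≠ ⊤ :=
      ENNReal.sum_ne_top.2 fun i _ => symmDist_ne_top (hsub _ (hf i)).2.1 (hsub _ (hf i)).2.2
    -- Minimality bounds the total for `F` by the total for the majority region; the latter is
    -- finite and cancels, leaving no room for the excess.
    have h2 : symmDist F (region m) = 0 := by
      have h3 := (hmaj hF).trans h1
      have h4 : (∑ i, symmDist (region m) (region (f i))) + symmDist F (region m) ≤
          (∑ i, symmDist (region m) (region (f i))) + 0 := by rwa [add_zero]
      exact le_antisymm ((ENNReal.add_le_add_iff_left hfin).1 h4) zero_le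
    -- The same `F` compares `S` with the envelope itself: sets equal up to null sets define the
    -- same 2-current, so the difference is the boundary of 0.
    obtain ⟨he, -, -⟩ := h m hmc
    rw [topCurrent_sub_eq_zero hF hmc.nullMeasurableSet h2] at he
    exact sub_eq_zero.1 (he.trans (by ext1; simp [boundary]))
  · rintro rfl
    refine ⟨hmc.graphCurrent_mem, fun S hS => ?_⟩
    obtain ⟨F, hF, h⟩ := exists_region_of_mem_boundaryPieces hS
    rw [hsum hS hF h, hsum hmc.graphCurrent_mem hmc.nullMeasurableSet hsub]
    gcongr (lam : ℝ≥0∞) * ?_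
    exact le_self_add.trans (hmaj hF)

/-! ### The three smooth inputs and the corner of their median. -/

/-- A bump around `1/2`, supported in `[1/4, 3/4]`. -/
def bump : ContDiffBump (1 / 2 : ℝ) := ⟨1 / 8, 1 / 4, by norm_num, by norm_num⟩

theorem bump_eq_zero {x : ℝ} (hx : x ∉ Icc (1 / 4 : ℝ) (3 / 4)) : bump x = 0 := by
  refine bump.zero_of_le_dist ?_
  change 1 / 4 ≤ _
  rw [Real.dist_eq, le_abs]
  by_contra! h
  exact hx ⟨by linarith [h.1, h.2], by linarith [h.1, h.2]⟩

/-- The segment at height `1`, perturbed by `u` near its middle. -/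
def perturbed (u : ℝ → ℝ) (x : ℝ) : ℝ := 1 + bump x * u x

theorem contDiff_perturbed {u : ℝ → ℝ} (hu : ContDiff ℝ ∞ u) : ContDiff ℝ ∞ (perturbed u) :=
  contDiff_const.add (bump.contDiff.mul hu)

theorem isCompetitor_perturbed {u : ℝ → ℝ} (hu : ContDiff ℝ ∞ u)
    (hb : ∀ x ∈ Icc (1 / 4 : ℝ) (3 / 4), |u x| ≤ 1 / 4) : IsCompetitor (perturbed u) := by
  have hbound (x : ℝ) : |bump x * u x| ≤ 1 / 4 := by
    by_cases hx : x ∈ Icc (1 / 4 : ℝ) (3 / 4)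
    · rw [abs_mul, abs_of_nonneg bump.nonneg]
      exact (mul_le_of_le_one_left (abs_nonneg _) bump.le_one).trans (hb x hx)
    · rw [bump_eq_zero hx]
      norm_num
  obtain ⟨K, hK⟩ : ∃ K, LipschitzWith K fun x => bump x * u x :=
    (bump.contDiff.mul hu).lipschitzWith_of_hasCompactSupport bump.hasCompactSupport.mul_right
      (n := ∞) (by simp)
  refine ⟨isProfile_of_contDiff (contDiff_perturbed hu) ((LipschitzWith.const 1).add hK),
    fun x hx => ?_, fun x => ?_, fun x => ?_⟩
  · rw [perturbed, bump_eq_zero hx, zero_mul, add_zero]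
  · rw [perturbed]
    linarith [(abs_le.1 (hbound x)).1]
  · rw [perturbed]
    linarith [(abs_le.1 (hbound x)).2]

/-- The three perturbations. -/
def perturbation : Fin 3 → ℝ → ℝ := ![fun _ => 0, fun x => x - 1 / 2, fun _ => 1 / 4]

theorem contDiff_perturbation (i : Fin 3) : ContDiff ℝ ∞ (perturbation i) := by
  fin_cases i
  · exact contDiff_const
  · exact contDiff_id.sub contDiff_const
  · exact contDiff_const

theorem abs_perturbation_le (i : Fin 3) {x : ℝ} (hx : x ∈ Icc (1 / 4 : ℝ) (3 / 4)) :
    |perturbation i x| ≤ 1 / 4 := by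
  fin_cases i
  · simp [perturbation]
  · change |x - 1 / 2| ≤ 1 / 4
    rw [abs_le]
    constructor <;> linarith [hx.1, hx.2]
  · change |(1 / 4 : ℝ)| ≤ 1 / 4
    norm_num

/-- The input curves. -/
def inputCurve (i : Fin 3) : ℝ → ℝ := perturbed (perturbation i)

theorem isCompetitor_inputCurve (i : Fin 3) : IsCompetitor (inputCurve i) :=
  isCompetitor_perturbed (contDiff_perturbation i) fun _ hx => abs_perturbation_le i hx

/-- The third perturbation $1/4$ is the largest value of $x-1/2$ on $[1/4,3/4]$, outside which the
bump vanishes. -/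
theorem inputCurve_le_two (i : Fin 3) (x : ℝ) : inputCurve i x ≤ inputCurve 2 x := by
  rw [inputCurve, inputCurve, perturbed, perturbed]
  by_cases hx : x ∈ Icc (1 / 4 : ℝ) (3 / 4)
  · have := (abs_le.1 (abs_perturbation_le i hx)).2
    gcongr
    · exact bump.nonneg
    · exact this
  · rw [bump_eq_zero hx, zero_mul, zero_mul]

/-- The upper envelope of the first two inputs, which is the median curve. -/
def medianCurve (x : ℝ) : ℝ := max (inputCurve 0 x) (inputCurve 1 x)

theorem inputCurve_zero (x : ℝ) : inputCurve 0 x = 1 := by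
  simp [inputCurve, perturbed, perturbation]

theorem inputCurve_one (x : ℝ) : inputCurve 1 x = 1 + bump x * (x - 1 / 2) := by
  simp [inputCurve, perturbed, perturbation]

theorem medianCurve_of_le {x : ℝ} (hx : x ≤ 1 / 2) : medianCurve x = 1 := by
  rw [medianCurve, inputCurve_zero, inputCurve_one, max_eq_left]
  nlinarith [bump.nonneg (x := x)]

theorem medianCurve_of_ge {x : ℝ} (hx : 1 / 2 ≤ x) : medianCurve x = inputCurve 1 x := by
  rw [medianCurve, inputCurve_zero, inputCurve_one, max_eq_right]
  nlinarith [bump.nonneg (x := x)]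

theorem isCompetitor_medianCurve : IsCompetitor medianCurve := by
  have h0 := isCompetitor_inputCurve 0
  have h1 := isCompetitor_inputCurve 1
  obtain ⟨K, hK⟩ := h0.lipschitz
  obtain ⟨L, hL⟩ := h1.lipschitz
  refine ⟨⟨⟨max K L, hK.max hL⟩, {1 / 2}, countable_singleton _, fun x hx => ?_⟩, fun x hx => ?_,
    fun x => (h0.le x).trans (le_max_left _ _), fun x => max_le (h0.ge x) (h1.ge x)⟩
  · have hs : ContDiffAt ℝ ∞ medianCurve x := by
      rcases lt_or_gt_of_ne (hx : x ≠ 1 / 2) with h | h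
      · refine (contDiffAt_const (c := (1 : ℝ))).congr_of_eventuallyEq ?_
        filter_upwards [Iio_mem_nhds h] with y hy using medianCurve_of_le (le_of_lt hy)
      · refine (contDiff_perturbed (contDiff_perturbation 1)).contDiffAt.congr_of_eventuallyEq ?_
        filter_upwards [Ioi_mem_nhds h] with y hy using medianCurve_of_ge (le_of_lt hy)
    exact hs.hasStrictDerivAt (by simp)
  · rw [medianCurve, h0.eq_one x hx, h1.eq_one x hx, max_self]

theorem not_isSmoothAt_medianCurve :
    ¬IsSmoothAt 1 (graphCurrent medianCurve) (graphMap medianCurve (1 / 2)) := by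
  refine not_isSmoothAt_of_corner isCompetitor_medianCurve.toIsProfile (a := 0) (b := 1)
    (by norm_num) ?_ ?_ zero_ne_one
  · exact (hasDerivWithinAt_const (1 / 2 : ℝ) _ (1 : ℝ)).congr
      (fun x hx => medianCurve_of_le hx) (medianCurve_of_le le_rfl)
  · have h1 : HasDerivAt (inputCurve 1) 1 (1 / 2) := by
      have hb : HasDerivAt bump (deriv bump (1 / 2)) (1 / 2) :=
        (bump.contDiff.differentiable (n := (1 : ℕ∞)) (by simp) _).hasDerivAt
      -- In the product rule the derivative of the bump is multiplied by $x-1/2=0$, and the bump is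
      -- 1 at the centre, so the right slope is 1.
      have h2 := (hb.mul ((hasDerivAt_id (1 / 2 : ℝ)).sub_const (1 / 2))).const_add 1
      have hv : bump (1 / 2) = 1 := bump.one_of_mem_closedBall (by simp [bump.rIn_pos.le])
      simp only [id, sub_self, mul_zero, zero_add, mul_one, hv] at h2
      have e : inputCurve 1 = fun x => 1 + bump x * (x - 1 / 2) := funext inputCurve_one
      rw [e]
      exact h2
    exact h1.hasDerivWithinAt.congr (fun x hx => medianCurve_of_ge hx) (medianCurve_of_ge le_rfl)

end

end MedianCurrents

theorem mainTheorem4 :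
    ∃ (N : ℕ) (f : Fin N → ℝ → ℝ) (E U : Set Plane) (T : Fin N → Current 1) (p : Plane),
      0 < N ∧
      -- the inputs are oriented graphs of smooth functions with common end points
      (∀ i, ContDiff ℝ ∞ (f i) ∧ f i 0 = 1 ∧ f i 1 = 1 ∧ IsGraphCurrent (f i) (T i)) ∧
      (∀ i, ∀ q ∈ interiorPoints (T i), IsSmoothAt ⊤ (T i) q) ∧
      (∀ i j, boundary (T i) = boundary (T j)) ∧
      -- they are pieces of boundaries of sets
      IsAdmissible E U ∧ (∀ i, T i ∈ boundaryPieces E U) ∧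
      -- every small scale is small enough
      (∃ lam₀ : ℝ≥0, 0 < lam₀ ∧ ∀ lam : ℝ≥0, 0 < lam → lam < lam₀ → FlatNormFills lam E U T) ∧
      -- at every such scale there are medians, and all of them fail to be smooth
      ∀ lam : ℝ≥0, 0 < lam → FlatNormFills lam E U T →
        (∃ M, IsMedian lam E U T M) ∧
          ∀ M, IsMedian lam E U T M → p ∈ interiorPoints M ∧ ¬ IsSmoothAt 1 M p := by
  have hc := isCompetitor_inputCurve
  have hs (i : Fin 3) : ContDiff ℝ ∞ (inputCurve i) := contDiff_perturbed (contDiff_perturbation i)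
  have hmc := isCompetitor_medianCurve
  refine ⟨3, inputCurve, baseRegion, window, fun i => graphCurrent (inputCurve i),
    graphMap medianCurve (1 / 2), by norm_num,
    fun i => ⟨hs i, (hc i).at_zero, (hc i).at_one, isGraphCurrent_graphCurrent (hc i).toIsProfile⟩,
    fun i q hq => isSmoothAt_graphCurrent (hc i).toIsProfile (hs i) hq,
    fun i j => boundary_graphCurrent_congr (hc i).toIsProfile (hc j).toIsProfile
      ((hc i).at_zero.trans (hc j).at_zero.symm) ((hc i).at_one.trans (hc j).at_one.symm),
    isAdmissible_base, fun i => (hc i).graphCurrent_mem,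
    ⟨1 / 9, by norm_num, fun lam _ hlam => flatNormFills_of_le hc ?_⟩, fun lam hlam hfill => ?_⟩
  · have h : (lam : ℝ) < (1 / 9 : ℝ≥0) := NNReal.coe_lt_coe.2 hlam
    push_cast at h
    linarith
  · have key := isMedian_iff_eq_graphCurrent hc hmc rfl (inputCurve_le_two 0) (inputCurve_le_two 1)
      hlam hfill
    refine ⟨⟨_, (key _).2 rfl⟩, fun M hM => ?_⟩
    rw [(key M).1 hM, interiorPoints_graphCurrent hmc.toIsProfile]
    exact ⟨mem_image_of_mem _ (by norm_num), not_isSmoothAt_medianCurve⟩
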